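/- Let $\Omega\subset\mathbb R^n$ be a bounded open set with smooth boundary, $Z=H^1(\Omega)$ (real scalars, with norm $(\|v\|_{L^2}^2+\|\nabla v\|_{L^2}^2)^{1/2}$), and $\Gamma\subseteq\partial\Omega$. Let $H^{1/2}(\Gamma)$ be the space of restrictions to $\Gamma$ (modulo equality almost everywhere for the surface measure) of traces of functions in $H^1(\Omega)$, with the Hilbert norm $\|z\|_{H^{1/2}(\Gamma)}=\inf\{\|v\|_{H^1(\Omega)}: \text{the trace of } v \text{ equals } z \text{ on } \Gamma\}$; for $\Gamma=\partial\Omega$ this is $H^{1/2}(\partial\Omega)$. Let $\gamma:H^1(\Omega)\to H^{1/2}(\partial\Omega)$ be the trace operator of order zero and $p_\Gamma:H^{1/2}(\partial\Omega)\to H^{1/2}(\Gamma)$, $p_\Gamma z=z|_\Gamma$, the restriction operator. Let $\alpha\in(0,1]$, $b>0$, $z_0\in Z$, let $A$ generate a strongly continuous semigroup $\{\Phi(t)\}_{t\ge0}$ on $Z$, and let $B:\mathbb R^p\to Z$ be linear. Consider the system $${}_0D_t^\alpha z(t)=Az(t)+Bu(t),\quad t\in[0,b],\qquad \lim_{t\to0^+}{}_0I_t^{1-\alpha}z(t)=z_0,$$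 where ${}_0I_t^{1-\alpha}$ and ${}_0D_t^\alpha$ are the Riemann–Liouville integral and derivative and $u\in L^2(0,b;\mathbb R^p)$. Its mild solution is, by definition, $$z(t,u)=K_\alpha(t)z_0+\int_0^t(t-s)^{\alpha-1}K_\alpha(t-s)Bu(s)\,ds,\qquad K_\alpha(t)=\alpha\int_0^\infty\theta\phi_\alpha(\theta)\Phi(t^\alpha\theta)\,d\theta,$$ with $\phi_\alpha(\theta)=\frac1\alpha\theta^{-1-1/\alpha}\psi_\alpha(\theta^{-1/\alpha})$ and $\psi_\alpha(\theta)=\frac1\pi\sum_{m=1}^\infty(-1)^{m-1}\theta^{-\alpha m-1}\frac{\Gamma(m\alpha+1)}{m!}\sin(m\pi\alpha)$ for $\alpha<1$, and $K_1(t)=\Phi(t)$ for $\alpha=1$. Put $$Hu=\int_0^b(b-s)^{\alpha-1}K_\alpha(b-s)Bu(s)\,ds,$$ and assume that this integral converges absolutely in $Z$ for every $u\in L^2(0,b;\mathbb R^p)$, so that $H$ is defined on all of $L^2(0,b;\mathbb R^p)$ (this is automatic if $\alpha>1/2$). Then $H:L^2(0,b;\mathbb R^p)\to Z$ is a bounded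 linear operator, and the following properties are equivalent. 1. The system is exactly regionally boundary controllable on $\Gamma$ at time $b$: for every $z_b\in H^{1/2}(\Gamma)$ there is $u\in L^2(0,b;\mathbb R^p)$ with $p_\Gamma(\gamma z(b,u))=z_b$. 2. $\mathrm{Im}(p_\Gamma\gamma H)=H^{1/2}(\Gamma)$. 3. $\mathrm{Ker}(p_\Gamma)+\mathrm{Im}(\gamma H)=H^{1/2}(\partial\Omega)$. 4. There is a constant $c>0$ such that for all $z\in H^{1/2}(\Gamma)$ $$\|z\|_{H^{1/2}(\Gamma)}\le c\,\|H^*\gamma^*p_\Gamma^*z\|_{L^2(0,b;\mathbb R^p)},$$ where $H^*$, $\gamma^*$, $p_\Gamma^*$ are the Hilbert space adjoints. -/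

import Mathlib

open MeasureTheory Filter Topology Set
open scoped ENNReal ContDiff

noncomputable section

namespace RegionalControl

/-! ## The Sobolev space `H¹(Ω)` -/

/-- `L²(Ω)`. -/
abbrev L2 {n : ℕ} (Ω : Set (EuclideanSpace ℝ (Fin n))) : Type :=
  Lp ℝ 2 (volume.restrict Ω)

/-- `L²(Ω; ℝⁿ)`. -/
abbrev L2Vec {n : ℕ} (Ω : Set (EuclideanSpace ℝ (Fin n))) : Type :=
  Lp (EuclideanSpace ℝ (Fin n)) 2 (volume.restrict Ω)

/-- Test functions: smooth with compact support contained in `Ω`. -/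
def IsTestFunction {n : ℕ} (Ω : Set (EuclideanSpace ℝ (Fin n)))
    (φ : EuclideanSpace ℝ (Fin n) → ℝ) : Prop :=
  ContDiff ℝ ∞ φ ∧ HasCompactSupport φ ∧ tsupport φ ⊆ Ω

/-- The `i`-th partial derivative of `φ`. -/
def pderiv {n : ℕ} (i : Fin n) (φ : EuclideanSpace ℝ (Fin n) → ℝ)
    (x : EuclideanSpace ℝ (Fin n)) : ℝ :=
  fderiv ℝ φ x (EuclideanSpace.single i 1)

/-- `g ∈ L²(Ω; ℝⁿ)` is the weak gradient of `v ∈ L²(Ω)`. -/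
def IsWeakGradient {n : ℕ} {Ω : Set (EuclideanSpace ℝ (Fin n))} (v : L2 Ω) (g : L2Vec Ω) : Prop :=
  ∀ φ : EuclideanSpace ℝ (Fin n) → ℝ, IsTestFunction Ω φ → ∀ i : Fin n,
    ∫ x in Ω, v x * pderiv i φ x = - ∫ x in Ω, g x i * φ x

theorem IsTestFunction.memLp {n : ℕ} {Ω : Set (EuclideanSpace ℝ (Fin n))}
    {φ : EuclideanSpace ℝ (Fin n) → ℝ} (h : IsTestFunction Ω φ) :
    MemLp φ 2 (volume.restrict Ω) :=
  (h.1.continuous.memLp_of_hasCompactSupport h.2.1).restrict Ω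

theorem IsTestFunction.memLp_pderiv {n : ℕ} {Ω : Set (EuclideanSpace ℝ (Fin n))}
    {φ : EuclideanSpace ℝ (Fin n) → ℝ} (h : IsTestFunction Ω φ) (i : Fin n) :
    MemLp (pderiv i φ) 2 (volume.restrict Ω) := by
  have hc : Continuous (pderiv i φ) :=
    (h.1.continuous_fderiv (by simp)).clm_apply continuous_const
  have hs : HasCompactSupport (pderiv i φ) := by
    refine (h.2.1.fderiv (𝕜 := ℝ)).mono ?_
    intro x hx
    simp only [Function.mem_support, pderiv] at hx ⊢
    intro h0
    exact hx (by rw [h0]; rfl)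
  exact (hc.memLp_of_hasCompactSupport hs).restrict Ω

/-- The weak gradient condition as an orthogonality relation. -/
theorem isWeakGradient_iff {n : ℕ} {Ω : Set (EuclideanSpace ℝ (Fin n))} (v : L2 Ω) (g : L2Vec Ω) :
    IsWeakGradient v g ↔
      ∀ φ : EuclideanSpace ℝ (Fin n) → ℝ, ∀ h : IsTestFunction Ω φ, ∀ i : Fin n,
        inner ℝ v ((h.memLp_pderiv i).toLp _) +
          inner ℝ g (((ContinuousLinearMap.toSpanSingleton ℝ
            (EuclideanSpace.single i (1 : ℝ))).comp_memLp' h.memLp).toLp _) = 0 := by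
  unfold IsWeakGradient
  refine forall_congr' fun φ => forall_congr' fun h => forall_congr' fun i => ?_
  rw [eq_neg_iff_add_eq_zero, L2.inner_def, L2.inner_def]
  have e1 : ∫ x in Ω, v x * pderiv i φ x =
      ∫ x in Ω, inner ℝ (v x) (((h.memLp_pderiv i).toLp _ : L2 Ω) x) := by
    refine integral_congr_ae ?_
    filter_upwards [(h.memLp_pderiv i).coeFn_toLp] with x hx
    rw [hx]; simp [mul_comm]
  have e2 : ∫ x in Ω, g x i * φ x =
      ∫ x in Ω, inner ℝ (g x) ((((ContinuousLinearMap.toSpanSingleton ℝ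
            (EuclideanSpace.single i (1 : ℝ))).comp_memLp' h.memLp).toLp _ : L2Vec Ω) x) := by
    refine integral_congr_ae ?_
    filter_upwards [((ContinuousLinearMap.toSpanSingleton ℝ
            (EuclideanSpace.single i (1 : ℝ))).comp_memLp' h.memLp).coeFn_toLp] with x hx
    rw [hx]
    rw [Function.comp_apply, ContinuousLinearMap.toSpanSingleton_apply, inner_smul_right,
      EuclideanSpace.inner_single_right]
    simp [mul_comm]
  rw [e1, e2]

/-- `H¹(Ω)`, as the subspace of `L²(Ω) × L²(Ω; ℝⁿ)` of the pairs `(v, ∇v)`, `∇v` being the weak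
gradient of `v`; the ambient Hilbert norm is `(‖v‖² + ‖∇v‖²)^(1/2)`. -/
def sobolevH1 {n : ℕ} (Ω : Set (EuclideanSpace ℝ (Fin n))) :
    Submodule ℝ (WithLp 2 (L2 Ω × L2Vec Ω)) where
  carrier := {w | IsWeakGradient w.fst w.snd}
  zero_mem' := by
    rw [mem_ofPred_eq, isWeakGradient_iff]
    intro φ h i
    simp
  add_mem' := by
    intro a b ha hb
    rw [mem_ofPred_eq, isWeakGradient_iff] at *
    intro φ h i
    have h1 := ha φ h i
    have h2 := hb φ h i
    simp only [WithLp.add_fst, WithLp.add_snd, inner_add_left]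
    linarith
  smul_mem' := by
    intro c a ha
    rw [mem_ofPred_eq, isWeakGradient_iff] at *
    intro φ h i
    have h1 := ha φ h i
    simp only [WithLp.smul_fst, WithLp.smul_snd, real_inner_smul_left]
    rw [← mul_add, h1, mul_zero]

/-- The Hilbert space `H¹(Ω)`. -/
abbrev H1 {n : ℕ} (Ω : Set (EuclideanSpace ℝ (Fin n))) : Type := ↥(sobolevH1 Ω)

theorem isClosed_sobolevH1 {n : ℕ} (Ω : Set (EuclideanSpace ℝ (Fin n))) :
    IsClosed (sobolevH1 Ω : Set (WithLp 2 (L2 Ω × L2Vec Ω))) := by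
  have : (sobolevH1 Ω : Set (WithLp 2 (L2 Ω × L2Vec Ω))) =
      ⋂ (φ : EuclideanSpace ℝ (Fin n) → ℝ) (h : IsTestFunction Ω φ) (i : Fin n),
        {w | inner ℝ w.fst ((h.memLp_pderiv i).toLp _) +
          inner ℝ w.snd (((ContinuousLinearMap.toSpanSingleton ℝ
            (EuclideanSpace.single i (1 : ℝ))).comp_memLp' h.memLp).toLp _) = 0} := by
    ext w
    simp only [mem_iInter]
    exact isWeakGradient_iff w.fst w.snd
  rw [this]
  refine isClosed_iInter fun φ => isClosed_iInter fun h => isClosed_iInter fun i => ?_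
  refine isClosed_eq ?_ continuous_const
  exact (((WithLp.fstL 2 ℝ (L2 Ω) (L2Vec Ω)).continuous).inner continuous_const).add
    (((WithLp.sndL 2 ℝ (L2 Ω) (L2Vec Ω)).continuous).inner continuous_const)

instance {n : ℕ} (Ω : Set (EuclideanSpace ℝ (Fin n))) : CompleteSpace (H1 Ω) :=
  (isClosed_sobolevH1 Ω).completeSpace_coe

/-! ## Smooth domains, traces and the spaces `H^{1/2}` -/

/-- Bounded open subsets of `ℝⁿ` with smooth boundary: near each boundary point, `Ω` is the
sublevel set `{ρ < 0}` of a smooth function `ρ` with non-zero differential. -/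
structure IsSmoothBoundedDomain {n : ℕ} (Ω : Set (EuclideanSpace ℝ (Fin n))) : Prop where
  isOpen : IsOpen Ω
  isBounded : Bornology.IsBounded Ω
  smooth_boundary : ∀ x ∈ frontier Ω, ∃ U ∈ 𝓝 x, ∃ ρ : EuclideanSpace ℝ (Fin n) → ℝ,
    ContDiff ℝ ∞ ρ ∧ fderiv ℝ ρ x ≠ 0 ∧ ∀ y ∈ U, y ∈ Ω ↔ ρ y < 0

/-- The surface measure of `∂Ω`, that is, `(n-1)`-dimensional Hausdorff measure. -/
def surfaceMeasure {n : ℕ} (Ω : Set (EuclideanSpace ℝ (Fin n))) :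
    Measure (EuclideanSpace ℝ (Fin n)) :=
  (Measure.hausdorffMeasure ((n : ℝ) - 1)).restrict (frontier Ω)

/-- `L²(∂Ω)`. -/
abbrev L2Bdry {n : ℕ} (Ω : Set (EuclideanSpace ℝ (Fin n))) : Type :=
  Lp ℝ 2 (surfaceMeasure Ω)

/-- The pairs `(φ|_Ω, φ|_∂Ω)` in `H¹(Ω) × L²(∂Ω)`, for `φ` smooth with compact support in `ℝⁿ`. -/
def smoothTraceGraph {n : ℕ} (Ω : Set (EuclideanSpace ℝ (Fin n))) :
    Submodule ℝ (H1 Ω × L2Bdry Ω) where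
  carrier := {w | ∃ φ : EuclideanSpace ℝ (Fin n) → ℝ, ContDiff ℝ ∞ φ ∧ HasCompactSupport φ ∧
    ((w.1 : WithLp 2 (L2 Ω × L2Vec Ω)).fst : EuclideanSpace ℝ (Fin n) → ℝ)
      =ᵐ[volume.restrict Ω] φ ∧
    (w.2 : EuclideanSpace ℝ (Fin n) → ℝ) =ᵐ[surfaceMeasure Ω] φ}
  zero_mem' := ⟨0, contDiff_const, HasCompactSupport.zero, Lp.coeFn_zero _ _ _,
    Lp.coeFn_zero _ _ _⟩
  add_mem' := by
    rintro a b ⟨φ, hφ, hφc, h1, h2⟩ ⟨ψ, hψ, hψc, h3, h4⟩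
    exact ⟨φ + ψ, hφ.add hψ, hφc.add hψc, (Lp.coeFn_add _ _).trans (h1.add h3),
      (Lp.coeFn_add _ _).trans (h2.add h4)⟩
  smul_mem' := by
    rintro c a ⟨φ, hφ, hφc, h1, h2⟩
    exact ⟨c • φ, hφ.const_smul c, hφc.smul_left (f := fun _ => c),
      (Lp.coeFn_smul _ _).trans (h1.const_smul c), (Lp.coeFn_smul _ _).trans (h2.const_smul c)⟩

/-- `g ∈ L²(∂Ω)` is the trace of order zero of `v ∈ H¹(Ω)`: some smooth functions `φₖ` satisfy
`φₖ → v` in `H¹(Ω)` and `φₖ|_∂Ω → g` in `L²(∂Ω)`. -/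
def HasTrace {n : ℕ} {Ω : Set (EuclideanSpace ℝ (Fin n))} (v : H1 Ω) (g : L2Bdry Ω) : Prop :=
  (v, g) ∈ (smoothTraceGraph Ω).topologicalClosure

/-- The functions `v ∈ H¹(Ω)` whose trace vanishes almost everywhere on `Γ ⊆ ∂Ω`. -/
def vanishingTrace {n : ℕ} (Ω Γ : Set (EuclideanSpace ℝ (Fin n))) : Submodule ℝ (H1 Ω) where
  carrier := {v | ∃ g : L2Bdry Ω, HasTrace v g ∧ ∀ᵐ x ∂(surfaceMeasure Ω), x ∈ Γ → g x = 0}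
  zero_mem' := by
    refine ⟨0, Submodule.zero_mem _, ?_⟩
    filter_upwards [Lp.coeFn_zero ℝ 2 (surfaceMeasure Ω)] with x hx _
    exact hx
  add_mem' := by
    rintro v w ⟨g, hg, hg0⟩ ⟨k, hk, hk0⟩
    refine ⟨g + k, Submodule.add_mem _ hg hk, ?_⟩
    filter_upwards [Lp.coeFn_add g k, hg0, hk0] with x hx h1 h2 hΓ
    rw [hx, Pi.add_apply, h1 hΓ, h2 hΓ, add_zero]
  smul_mem' := by
    rintro c v ⟨g, hg, hg0⟩
    refine ⟨c • g, Submodule.smul_mem _ c hg, ?_⟩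
    filter_upwards [Lp.coeFn_smul c g, hg0] with x hx h1 hΓ
    rw [hx, Pi.smul_apply, h1 hΓ, smul_zero]

/-- `vanishingTrace` as a closed subspace. For a smooth bounded domain `vanishingTrace` is closed
already, because the trace is continuous, and the closure changes nothing. -/
def traceKer {n : ℕ} (Ω Γ : Set (EuclideanSpace ℝ (Fin n))) : Submodule ℝ (H1 Ω) :=
  (vanishingTrace Ω Γ).topologicalClosure

instance {n : ℕ} (Ω Γ : Set (EuclideanSpace ℝ (Fin n))) :
    IsClosed (traceKer Ω Γ : Set (H1 Ω)) :=
  Submodule.isClosed_topologicalClosure _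

instance {n : ℕ} (Ω Γ : Set (EuclideanSpace ℝ (Fin n))) : CompleteSpace (traceKer Ω Γ) :=
  (Submodule.isClosed_topologicalClosure (vanishingTrace Ω Γ)).completeSpace_coe

/-- `H^{1/2}(Γ)` for `Γ ⊆ ∂Ω`: the space of the restrictions to `Γ` of the traces of the functions
`v ∈ H¹(Ω)`, with the norm `‖z‖ = inf {‖v‖_{H¹(Ω)} : the trace of v is z on Γ}`. Two functions in
`H¹(Ω)` stand for the same `z` when the trace of their difference vanishes on `Γ`, so this is the
quotient of `H¹(Ω)` with its quotient Hilbert norm. In particular `Hhalf Ω (frontier Ω)` is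
`H^{1/2}(∂Ω)`, the range of the trace operator. -/
def Hhalf {n : ℕ} (Ω Γ : Set (EuclideanSpace ℝ (Fin n))) : Type :=
  H1 Ω ⧸ traceKer Ω Γ

instance {n : ℕ} (Ω Γ : Set (EuclideanSpace ℝ (Fin n))) : NormedAddCommGroup (Hhalf Ω Γ) :=
  inferInstanceAs (NormedAddCommGroup (H1 Ω ⧸ traceKer Ω Γ))

instance {n : ℕ} (Ω Γ : Set (EuclideanSpace ℝ (Fin n))) : InnerProductSpace ℝ (Hhalf Ω Γ) :=
  inferInstanceAs (InnerProductSpace ℝ (H1 Ω ⧸ traceKer Ω Γ))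

instance {n : ℕ} (Ω Γ : Set (EuclideanSpace ℝ (Fin n))) : CompleteSpace (Hhalf Ω Γ) :=
  inferInstanceAs (CompleteSpace (H1 Ω ⧸ traceKer Ω Γ))

/-- The trace operator `γ : H¹(Ω) → H^{1/2}(∂Ω)`. -/
def γ {n : ℕ} (Ω : Set (EuclideanSpace ℝ (Fin n))) : H1 Ω →L[ℝ] Hhalf Ω (frontier Ω) :=
  (traceKer Ω (frontier Ω)).mkQL

theorem traceKer_frontier_le {n : ℕ} (Ω Γ : Set (EuclideanSpace ℝ (Fin n))) :
    traceKer Ω (frontier Ω) ≤ traceKer Ω Γ := by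
  refine Submodule.topologicalClosure_mono ?_
  rintro v ⟨g, hg, hg0⟩
  refine ⟨g, hg, ?_⟩
  have hm : ∀ᵐ x ∂(surfaceMeasure Ω), x ∈ frontier Ω :=
    ae_restrict_mem isClosed_frontier.measurableSet
  filter_upwards [hg0, hm] with x hx hx' _
  exact hx hx'

/-- The restriction operator `p_Γ : H^{1/2}(∂Ω) → H^{1/2}(Γ)`, `z ↦ z|_Γ`. -/
def pΓ {n : ℕ} (Ω Γ : Set (EuclideanSpace ℝ (Fin n))) :
    Hhalf Ω (frontier Ω) →L[ℝ] Hhalf Ω Γ :=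
  (traceKer Ω (frontier Ω)).liftQL (traceKer Ω Γ).mkQL (by
    intro v hv
    exact LinearMap.mem_ker.2
      ((Submodule.Quotient.mk_eq_zero _).2 (traceKer_frontier_le Ω Γ hv)))

/-- Functions with traces that agree on `Γ` have the same image in `H^{1/2}(Γ)`. -/
theorem pΓ_γ_eq_of_hasTrace {n : ℕ} {Ω Γ : Set (EuclideanSpace ℝ (Fin n))} {v w : H1 Ω}
    {g k : L2Bdry Ω} (hv : HasTrace v g) (hw : HasTrace w k)
    (h : ∀ᵐ x ∂(surfaceMeasure Ω), x ∈ Γ → g x = k x) : pΓ Ω Γ (γ Ω v) = pΓ Ω Γ (γ Ω w) := by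
  change (Submodule.Quotient.mk v : H1 Ω ⧸ traceKer Ω Γ) = Submodule.Quotient.mk w
  rw [Submodule.Quotient.eq]
  refine Submodule.le_topologicalClosure _ ⟨g - k, Submodule.sub_mem _ hv hw, ?_⟩
  filter_upwards [Lp.coeFn_sub g k, h] with x hx h1 hΓ
  rw [hx, Pi.sub_apply, h1 hΓ, sub_self]

/-! ## Semigroups, mild solutions and the control operator -/

/-- Strongly continuous semigroups of bounded operators on `Z` (the values at `t < 0` play no
role). -/
structure C0Semigroup (Z : Type*) [NormedAddCommGroup Z] [NormedSpace ℝ Z] where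
  toFun : ℝ → Z →L[ℝ] Z
  map_zero : toFun 0 = ContinuousLinearMap.id ℝ Z
  map_add : ∀ s t : ℝ, 0 ≤ s → 0 ≤ t → toFun (s + t) = (toFun s).comp (toFun t)
  tendsto_zero : ∀ z : Z, Tendsto (fun t => toFun t z) (𝓝[>] 0) (𝓝 z)

/-- `A`, with its domain, is the infinitesimal generator of the semigroup `Φ`:
`z ∈ D(A)` and `A z = y` if and only if `(Φ(h) z - z) / h → y` as `h → 0+`. -/
def IsGenerator {Z : Type*} [NormedAddCommGroup Z] [NormedSpace ℝ Z]
    (A : Z →ₗ.[ℝ] Z) (Φ : C0Semigroup Z) : Prop :=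
  ∀ z y : Z, (z, y) ∈ A.graph ↔
    Tendsto (fun h : ℝ => h⁻¹ • (Φ.toFun h z - z)) (𝓝[>] 0) (𝓝 y)

/-- `ψ_α(θ) = (1/π) ∑_{m ≥ 1} (-1)^{m-1} θ^{-αm-1} (Γ(mα+1)/m!) sin(mπα)`, with `m = k + 1`. -/
def psi (α θ : ℝ) : ℝ :=
  (1 / Real.pi) * ∑' k : ℕ, (-1 : ℝ) ^ k * θ ^ (-α * ((k : ℝ) + 1) - 1) *
    (Real.Gamma (((k : ℝ) + 1) * α + 1) / ((k + 1).factorial : ℝ)) *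
    Real.sin (((k : ℝ) + 1) * Real.pi * α)

/-- `φ_α(θ) = (1/α) θ^{-1-1/α} ψ_α(θ^{-1/α})`. -/
def phi (α θ : ℝ) : ℝ :=
  (1 / α) * θ ^ (-1 - 1 / α) * psi α (θ ^ (-1 / α))

/-- `K_α(t) = α ∫_0^∞ θ φ_α(θ) Φ(t^α θ) dθ`. For `α = 1` the probability density `φ_α` degenerates
to the Dirac mass at `1`, and `K_1(t) = Φ(t)`. -/
def K {Z : Type*} [NormedAddCommGroup Z] [NormedSpace ℝ Z] (Φ : C0Semigroup Z)
    (α t : ℝ) (z : Z) : Z :=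
  if α = 1 then Φ.toFun t z
  else α • ∫ θ in Ioi (0 : ℝ), (θ * phi α θ) • Φ.toFun (t ^ α * θ) z

/-- The space of controls `L²(0, b; ℝᵖ)`. -/
abbrev Controls (p : ℕ) (b : ℝ) : Type :=
  Lp (EuclideanSpace ℝ (Fin p)) 2 (volume.restrict (Ioo (0 : ℝ) b))

/-- The function `s ↦ (t-s)^{α-1} K_α(t-s) B u(s)`. -/
def controlIntegrand {Z : Type*} [NormedAddCommGroup Z] [NormedSpace ℝ Z] {p : ℕ}
    (Φ : C0Semigroup Z) (α : ℝ) (B : EuclideanSpace ℝ (Fin p) →L[ℝ] Z) {b : ℝ}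
    (u : Controls p b) (t s : ℝ) : Z :=
  (t - s) ^ (α - 1) • K Φ α (t - s) (B (u s))

/-- The mild solution `z(t, u) = K_α(t) z₀ + ∫_0^t (t-s)^{α-1} K_α(t-s) B u(s) ds`. -/
def mildSolution {Z : Type*} [NormedAddCommGroup Z] [NormedSpace ℝ Z] {p : ℕ}
    (Φ : C0Semigroup Z) (α : ℝ) (B : EuclideanSpace ℝ (Fin p) →L[ℝ] Z) (z₀ : Z) {b : ℝ}
    (u : Controls p b) (t : ℝ) : Z :=
  K Φ α t z₀ + ∫ s in Ioo 0 t, controlIntegrand Φ α B u t s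

/-- The operator `T` is `u ↦ ∫_0^b (b-s)^{α-1} K_α(b-s) B u(s) ds`. -/
def IsControlOperator {Z : Type*} [NormedAddCommGroup Z] [NormedSpace ℝ Z] {p : ℕ}
    (Φ : C0Semigroup Z) (α : ℝ) (B : EuclideanSpace ℝ (Fin p) →L[ℝ] Z) (b : ℝ)
    (T : Controls p b →L[ℝ] Z) : Prop :=
  ∀ u : Controls p b, T u = ∫ s in Ioo 0 b, controlIntegrand Φ α B u b s

open Classical in
/-- `H : L²(0, b; ℝᵖ) → Z`, `H u = ∫_0^b (b-s)^{α-1} K_α(b-s) B u(s) ds`, as a bounded operator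
(with the value `0` in case that this formula does not define a bounded operator). -/
def H {Z : Type*} [NormedAddCommGroup Z] [NormedSpace ℝ Z] {p : ℕ}
    (Φ : C0Semigroup Z) (α : ℝ) (B : EuclideanSpace ℝ (Fin p) →L[ℝ] Z) (b : ℝ) :
    Controls p b →L[ℝ] Z :=
  if h : ∃ T : Controls p b →L[ℝ] Z, IsControlOperator Φ α B b T then h.choose else 0

/-- Exact regional boundary controllability on `Γ` at time `b`. -/
def IsExactlyRegionallyBoundaryControllable {n p : ℕ} {Ω : Set (EuclideanSpace ℝ (Fin n))}
    (Γ : Set (EuclideanSpace ℝ (Fin n))) (Φ : C0Semigroup (H1 Ω)) (α : ℝ)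
    (B : EuclideanSpace ℝ (Fin p) →L[ℝ] H1 Ω) (z₀ : H1 Ω) (b : ℝ) : Prop :=
  ∀ z_b : Hhalf Ω Γ, ∃ u : Controls p b, pΓ Ω Γ (γ Ω (mildSolution Φ α B z₀ u b)) = z_b

end RegionalControl

end

/-! ## The Gamma integral along rays -/

/-! The equivalences are soft. The mild solution at time `b` is a fixed vector plus `H u`, so
properties 1 and 2 differ by a translation. Every element of H^{1/2}(Γ) comes from some v in H¹(Ω),
so p_Γ is onto, which links 2 and 3. Properties 2 and 4 are linked by the fact that T = p_Γ γ H is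
onto exactly when T* is bounded below (`ContinuousLinearMap.surjective_iff_exists_norm_le_adjoint`).

The work lies in the boundedness of `H`. By the closed graph theorem, sending u to its integrand is
bounded from L² to L¹(0,b;Z), because L² convergence gives a.e. convergence along a subsequence and,
for fixed s, the integrand is a bounded operator applied to u(s). This needs K_α(t) bounded, hence
integrability of θ φ_α(θ) Φ(t^α θ)z. As Φ may grow exponentially at any rate, φ_α must decay faster
than every exponential (`abs_phi_le`).

That decay is invisible in the alternating series for φ_α. But π φ_α(θ) is the imaginary part of the
integral of σ^(α-1) exp(σ - θσ^α) along a ray from 0 into the left half plane: expanding exp(-θσ^α)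
yields Gamma integrals (`hasSum_wright`). Moving the start of the ray to R > 0 changes the integral
only by a real number (`im_integral_wrightKernel_eq`). On the moved ray Re σ^α is bounded below by a
constant that grows without bound with R, and this gives any prescribed exponential rate in θ. -/

theorem integrableOn_rpow_mul_exp_neg_mul {s c : ℝ} (hs : -1 < s) (hc : 0 < c) :
    IntegrableOn (fun t : ℝ => t ^ s * Real.exp (-c * t)) (Ioi 0) := by
  simpa using integrableOn_rpow_mul_exp_neg_mul_rpow hs one_pos hc

theorem integrableOn_rpow_mul_cexp_neg_mul {s : ℝ} (hs : -1 < s) {r : ℂ} (hr : 0 < r.re) :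
    IntegrableOn (fun t : ℝ => ((t ^ s : ℝ) : ℂ) * Complex.exp (-(r * t))) (Ioi 0) := by
  refine (integrableOn_rpow_mul_exp_neg_mul hs hr).mono' ?_ ?_
  · exact (by fun_prop : Measurable
      (fun t : ℝ => ((t ^ s : ℝ) : ℂ) * Complex.exp (-(r * t)))).aestronglyMeasurable
  · refine (ae_restrict_mem measurableSet_Ioi).mono fun t (ht : 0 < t) => ?_
    rw [norm_mul, Complex.norm_real, Complex.norm_exp, Real.norm_of_nonneg (by positivity)]
    simp

theorem hasDerivAt_integral_rpow_mul_cexp {a : ℝ} (ha : 0 < a) {r : ℂ} (hr : 0 < r.re) :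
    HasDerivAt (fun r : ℂ => ∫ t in Ioi (0 : ℝ), ((t ^ (a - 1) : ℝ) : ℂ) * Complex.exp (-(r * t)))
      (-∫ t in Ioi (0 : ℝ), ((t ^ a : ℝ) : ℂ) * Complex.exp (-(r * t))) r := by
  rw [← integral_neg]
  have hs : {z : ℂ | r.re / 2 < z.re} ∈ 𝓝 r :=
    (isOpen_lt continuous_const Complex.continuous_re).mem_nhds (by simpa using hr)
  refine (hasDerivAt_integral_of_dominated_loc_of_deriv_le (μ := volume.restrict (Ioi (0 : ℝ)))
    (F := fun (r : ℂ) (t : ℝ) => ((t ^ (a - 1) : ℝ) : ℂ) * Complex.exp (-(r * t)))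
    (F' := fun (r : ℂ) (t : ℝ) => -(((t ^ a : ℝ) : ℂ) * Complex.exp (-(r * t))))
    (bound := fun t : ℝ => t ^ a * Real.exp (-(r.re / 2) * t)) hs ?_
    (integrableOn_rpow_mul_cexp_neg_mul (by linarith) hr) ?_ ?_
    (integrableOn_rpow_mul_exp_neg_mul (by linarith) (by linarith)) ?_).2
  · exact Eventually.of_forall fun z => (by fun_prop : Measurable
      (fun t : ℝ => ((t ^ (a - 1) : ℝ) : ℂ) * Complex.exp (-(z * t)))).aestronglyMeasurable
  · exact (by fun_prop : Measurable
      (fun t : ℝ => -(((t ^ a : ℝ) : ℂ) * Complex.exp (-(r * t))))).aestronglyMeasurable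
  · refine (ae_restrict_mem measurableSet_Ioi).mono fun t (ht : 0 < t) z (hz : r.re / 2 < z.re) => ?_
    rw [norm_neg, norm_mul, Complex.norm_real, Complex.norm_exp,
      Real.norm_of_nonneg (by positivity)]
    gcongr
    simp only [Complex.neg_re, Complex.mul_re, Complex.ofReal_re, Complex.ofReal_im]
    nlinarith
  · refine (ae_restrict_mem measurableSet_Ioi).mono fun t (ht : 0 < t) z _ => ?_
    have h1 : HasDerivAt (fun z : ℂ => -(z * t)) (-(1 * (t : ℂ))) z :=
      ((hasDerivAt_id z).mul_const _).neg
    have h2 := (h1.cexp).const_mul ((t ^ (a - 1) : ℝ) : ℂ)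
    convert! h2 using 1
    have : t ^ a = t ^ (a - 1) * t := by
      rw [Real.rpow_sub_one ht.ne']; field_simp
    rw [this]
    push_cast
    ring

/-- Integration by parts: the difference of the two integrands is the derivative of -t^a e^{-rt},
which vanishes at 0 and at infinity. -/
theorem mul_integral_rpow_mul_cexp {a : ℝ} (ha : 0 < a) {r : ℂ} (hr : 0 < r.re) :
    r * ∫ t in Ioi (0 : ℝ), ((t ^ a : ℝ) : ℂ) * Complex.exp (-(r * t)) =
      a * ∫ t in Ioi (0 : ℝ), ((t ^ (a - 1) : ℝ) : ℂ) * Complex.exp (-(r * t)) := by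
  have i1 := (integrableOn_rpow_mul_cexp_neg_mul (s := a) (by linarith) hr).const_mul r
  have i2 := (integrableOn_rpow_mul_cexp_neg_mul (s := a - 1) (by linarith) hr).const_mul (a : ℂ)
  rw [← integral_const_mul, ← integral_const_mul, ← sub_eq_zero, ← integral_sub i1 i2]
  have h := integral_Ioi_of_hasDerivAt_of_tendsto
    (f := fun t : ℝ => -(((t ^ a : ℝ) : ℂ) * Complex.exp (-(r * t)))) (a := 0) (m := 0)
    (f' := fun t => r * (((t ^ a : ℝ) : ℂ) * Complex.exp (-(r * t))) -
      a * (((t ^ (a - 1) : ℝ) : ℂ) * Complex.exp (-(r * t)))) ?_ ?_ (i1.sub i2) ?_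
  · rw [h]; simp [Real.zero_rpow ha.ne']
  · refine Continuous.continuousWithinAt ?_
    have := Real.continuous_rpow_const ha.le
    fun_prop
  · intro t (ht : 0 < t)
    have h1 : HasDerivAt (fun t : ℝ => ((t ^ a : ℝ) : ℂ)) ((a * t ^ (a - 1) : ℝ) : ℂ) t :=
      (Real.hasDerivAt_rpow_const (Or.inl ht.ne')).ofReal_comp
    have h2 : HasDerivAt (fun t : ℝ => -(r * (t : ℂ))) (-(r * 1)) t :=
      ((hasDerivAt_id t).ofReal_comp.const_mul r).neg
    convert! (h1.mul h2.cexp).neg using 1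
    push_cast
    ring
  · rw [tendsto_zero_iff_norm_tendsto_zero]
    refine (tendsto_rpow_mul_exp_neg_mul_atTop_nhds_zero a r.re hr).congr' ?_
    filter_upwards [eventually_gt_atTop 0] with t ht
    rw [norm_neg, norm_mul, Complex.norm_real, Complex.norm_exp,
      Real.norm_of_nonneg (by positivity)]
    simp

/-- Euler's integral for the Gamma function along a ray in the right half plane. -/
theorem integral_rpow_mul_cexp_neg_mul_Ioi {a : ℝ} (ha : 0 < a) {r : ℂ} (hr : 0 < r.re) :
    r ^ (a : ℂ) * ∫ t in Ioi (0 : ℝ), ((t ^ (a - 1) : ℝ) : ℂ) * Complex.exp (-(r * t)) =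
      (Real.Gamma a : ℂ) := by
  set F : ℂ → ℂ := fun r => r ^ (a : ℂ) *
    ∫ t in Ioi (0 : ℝ), ((t ^ (a - 1) : ℝ) : ℂ) * Complex.exp (-(r * t)) with hF
  -- Instead of rotating a contour: `F` has zero derivative on the connected right half plane, so
  -- its value is the one at r = 1, Euler's real integral.
  have hd : ∀ z : ℂ, 0 < z.re → HasDerivAt F 0 z := by
    intro z hz
    have hz0 : z ≠ 0 := by rintro rfl; simp at hz
    have h1 : HasDerivAt (fun z : ℂ => z ^ (a : ℂ)) (a * z ^ ((a : ℂ) - 1) * 1) z :=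
      (hasDerivAt_id z).cpow_const (Or.inl hz)
    convert! h1.mul (hasDerivAt_integral_rpow_mul_cexp ha hz) using 1
    have h2 := mul_integral_rpow_mul_cexp ha hz
    have h3 : z ^ (a : ℂ) = z ^ ((a : ℂ) - 1) * z := by
      rw [Complex.cpow_sub _ _ hz0, Complex.cpow_one]; field_simp
    rw [h3]
    linear_combination (z ^ ((a : ℂ) - 1)) * h2
  have ho : IsOpen {z : ℂ | 0 < z.re} := isOpen_lt continuous_const Complex.continuous_re
  have hc : IsPreconnected {z : ℂ | 0 < z.re} := (convex_halfSpace_re_gt 0).isPreconnected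
  have h := ho.is_const_of_deriv_eq_zero hc
    (fun z hz => (hd z hz).differentiableAt.differentiableWithinAt)
    (fun z hz => (hd z hz).deriv) hr (show (0 : ℝ) < (1 : ℂ).re by simp)
  change F r = _
  rw [h, hF]
  simp only [Complex.one_cpow, one_mul]
  rw [Real.Gamma_eq_integral ha, ← integral_complex_ofReal]
  refine setIntegral_congr_fun measurableSet_Ioi fun t _ => ?_
  push_cast
  ring

/-! ## A contour integral for the Wright function -/

/-- The integrand `σ^(α-1) exp(σ - θ σ^α)` of the Hankel type integral. -/
noncomputable def wrightKernel (α θ : ℝ) (σ : ℂ) : ℂ :=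
  σ ^ ((α - 1 : ℝ) : ℂ) * Complex.exp (σ - θ * σ ^ (α : ℂ))

/-- The point `R + t e^{iη}` of the ray from `R` in direction `e^{iη}`. -/
noncomputable def rayPoint (η R t : ℝ) : ℂ := R + t * Complex.exp (η * Complex.I)

theorem rayPoint_re (η R t : ℝ) : (rayPoint η R t).re = R + t * Real.cos η := by
  simp [rayPoint, Complex.exp_ofReal_mul_I_re, Complex.exp_ofReal_mul_I_im]

theorem rayPoint_im (η R t : ℝ) : (rayPoint η R t).im = t * Real.sin η := by
  simp [rayPoint, Complex.exp_ofReal_mul_I_re, Complex.exp_ofReal_mul_I_im]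

theorem continuous_rayPoint (η R : ℝ) : Continuous (rayPoint η R) := by
  unfold rayPoint; fun_prop

theorem hasDerivAt_rayPoint_left (η R t : ℝ) : HasDerivAt (fun R => rayPoint η R t) 1 R :=
  (hasDerivAt_id R).ofReal_comp.add_const _

theorem hasDerivAt_rayPoint (η R t : ℝ) :
    HasDerivAt (rayPoint η R) (Complex.exp (η * Complex.I)) t := by
  have h := ((hasDerivAt_id t).ofReal_comp.mul_const (Complex.exp (η * Complex.I))).const_add
    (R : ℂ)
  rw [Complex.ofReal_one, one_mul] at h
  exact h

theorem rayPoint_zero_right (η R : ℝ) : rayPoint η R 0 = R := by simp [rayPoint]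

theorem mul_sin_le_norm_rayPoint (η R t : ℝ) : t * Real.sin η ≤ ‖rayPoint η R t‖ := by
  rw [← rayPoint_im η R t]; exact (le_abs_self _).trans (Complex.abs_im_le_norm _)

/-- Both sides are the imaginary part of e^{iη} times the conjugate of the ray point. The identity
bounds the modulus from below and, through the sign of the sine, the argument from above. -/
theorem mul_sin_eq_norm_rayPoint (η R t : ℝ) :
    R * Real.sin η = ‖rayPoint η R t‖ * Real.sin (η - (rayPoint η R t).arg) := by
  rw [Real.sin_sub]
  have h1 := Complex.norm_mul_cos_arg (rayPoint η R t)
  have h2 := Complex.norm_mul_sin_arg (rayPoint η R t)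
  rw [rayPoint_re] at h1
  rw [rayPoint_im] at h2
  linear_combination (-Real.sin η) * h1 + Real.cos η * h2

theorem mul_sin_le_norm_rayPoint_left (η R t : ℝ) : R * Real.sin η ≤ ‖rayPoint η R t‖ := by
  rw [mul_sin_eq_norm_rayPoint η R t]
  exact mul_le_of_le_one_right (norm_nonneg _) (Real.sin_le_one _)

theorem rayPoint_arg_nonneg {η R t : ℝ} (hη : 0 < η) (hηπ : η < Real.pi) (ht : 0 ≤ t) :
    0 ≤ (rayPoint η R t).arg := by
  rw [Complex.arg_nonneg_iff, rayPoint_im]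
  exact mul_nonneg ht (Real.sin_pos_of_pos_of_lt_pi hη hηπ).le

theorem rayPoint_arg_le {η R t : ℝ} (hη : 0 < η) (hηπ : η < Real.pi) (hR : 0 ≤ R) :
    (rayPoint η R t).arg ≤ η := by
  by_contra! h
  have h0 : rayPoint η R t ≠ 0 := by
    intro h0; rw [h0, Complex.arg_zero] at h; linarith
  have h1 := mul_sin_eq_norm_rayPoint η R t
  have h2 : Real.sin (η - (rayPoint η R t).arg) < 0 :=
    Real.sin_neg_of_neg_of_neg_pi_lt (by linarith)
      (by linarith [Complex.arg_le_pi (rayPoint η R t)])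
  have h3 : 0 ≤ R * Real.sin η :=
    mul_nonneg hR (Real.sin_pos_of_pos_of_lt_pi hη hηπ).le
  have h4 : 0 < ‖rayPoint η R t‖ := norm_pos_iff.2 h0
  nlinarith

theorem rayPoint_mem_slitPlane {η R t : ℝ} (hη : 0 < η) (hηπ : η < Real.pi) (ht : 0 ≤ t)
    (h : 0 < R ∨ 0 < t) : rayPoint η R t ∈ Complex.slitPlane := by
  have hs := Real.sin_pos_of_pos_of_lt_pi hη hηπ
  rw [Complex.mem_slitPlane_iff, rayPoint_re, rayPoint_im]
  rcases ht.eq_or_lt with rfl | ht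
  · left; simpa using h
  · right; positivity

/-- On the ray the argument stays in [0, η], so Re σ^α = |σ|^α cos(α arg σ) ≥ cos(αη) m^α, where αη
< π/2 makes the cosine nonnegative. The lower bound `m` is left free because it is chosen
differently for fixed R and for R → 0. -/
theorem norm_wrightKernel_rayPoint_le {η R t α θ m : ℝ} (hη : 0 < η) (hηπ : η < Real.pi)
    (hR : 0 ≤ R) (ht : 0 ≤ t) (hα : 0 < α) (hα1 : α ≤ 1) (hαη : α * η < Real.pi / 2) (hθ : 0 ≤ θ)
    (hm : 0 < m) (hmσ : m ≤ ‖rayPoint η R t‖) :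
    ‖wrightKernel α θ (rayPoint η R t)‖ ≤ m ^ (α - 1) *
      Real.exp (R + t * Real.cos η - θ * (Real.cos (α * η) * m ^ α)) := by
  have hc : 0 ≤ Real.cos (α * η) :=
    Real.cos_nonneg_of_neg_pi_div_two_le_of_le (by nlinarith [Real.pi_pos]) hαη.le
  rw [wrightKernel, norm_mul, Complex.norm_cpow_real, Complex.norm_exp]
  refine mul_le_mul (Real.rpow_le_rpow_of_nonpos hm hmσ (by linarith)) ?_ (by positivity)
    (by positivity)
  rw [Complex.sub_re, rayPoint_re, Complex.re_ofReal_mul, Complex.cpow_ofReal_re,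
    mul_comm (Real.cos _)]
  gcongr
  have h1 := rayPoint_arg_nonneg hη hηπ ht (R := R)
  have h2 := rayPoint_arg_le hη hηπ hR (t := t)
  refine Real.cos_le_cos_of_nonneg_of_le_pi (by positivity) ?_ ?_
  · linarith [Real.pi_pos]
  · rw [mul_comm]; gcongr

theorem hasDerivAt_wrightKernel (α θ : ℝ) {σ : ℂ} (hσ : σ ∈ Complex.slitPlane) :
    HasDerivAt (wrightKernel α θ)
      (wrightKernel α θ σ * (((α - 1 : ℝ) : ℂ) * σ⁻¹ + 1 - θ * α * σ ^ ((α - 1 : ℝ) : ℂ))) σ := by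
  have h0 := Complex.slitPlane_ne_zero hσ
  have h1 : HasDerivAt (fun z : ℂ => z ^ ((α - 1 : ℝ) : ℂ))
      (((α - 1 : ℝ) : ℂ) * σ ^ (((α - 1 : ℝ) : ℂ) - 1) * 1) σ :=
    (hasDerivAt_id σ).cpow_const hσ
  have h2 : HasDerivAt (fun z : ℂ => z ^ (α : ℂ)) ((α : ℂ) * σ ^ ((α : ℂ) - 1) * 1) σ :=
    (hasDerivAt_id σ).cpow_const hσ
  have h3 := h1.mul (((hasDerivAt_id σ).sub (h2.const_mul (θ : ℂ))).cexp)
  convert! h3 using 1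
  rw [Complex.cpow_sub _ _ h0, Complex.cpow_one]
  simp only [wrightKernel, id, Pi.sub_apply]
  push_cast
  ring

theorem continuousOn_wrightKernel (α θ : ℝ) :
    ContinuousOn (wrightKernel α θ) Complex.slitPlane := fun _ hσ =>
  (hasDerivAt_wrightKernel α θ hσ).continuousAt.continuousWithinAt

theorem aestronglyMeasurable_comp_rayPoint {η R : ℝ} (hη : 0 < η) (hηπ : η < Real.pi)
    {f : ℂ → ℂ} (hf : ContinuousOn f Complex.slitPlane) :
    AEStronglyMeasurable (fun t => f (rayPoint η R t)) (volume.restrict (Ioi 0)) :=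
  (hf.comp (continuous_rayPoint η R).continuousOn fun _ ht =>
    rayPoint_mem_slitPlane hη hηπ (le_of_lt ht) (Or.inr ht)).aestronglyMeasurable measurableSet_Ioi

/-- The ray from the positive number `R` may be moved without changing the imaginary part. -/
theorem hasDerivAt_integral_wrightKernel {η R α θ : ℝ} (hη : Real.pi / 2 < η) (hηπ : η < Real.pi)
    (hR : 0 < R) (hα : 0 < α) (hα1 : α ≤ 1) (hαη : α * η < Real.pi / 2) (hθ : 0 ≤ θ) :
    HasDerivAt (fun R => Complex.exp (η * Complex.I) *
      ∫ t in Ioi (0 : ℝ), wrightKernel α θ (rayPoint η R t)) (-wrightKernel α θ R) R := by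
  have hη0 : 0 < η := by linarith [Real.pi_pos]
  have hs := Real.sin_pos_of_pos_of_lt_pi hη0 hηπ
  have hc : Real.cos η < 0 := Real.cos_neg_of_pi_div_two_lt_of_lt hη (by linarith)
  have hcα : 0 ≤ Real.cos (α * η) :=
    Real.cos_nonneg_of_neg_pi_div_two_le_of_le (by nlinarith [Real.pi_pos]) hαη.le
  -- A distance from the origin valid for all starting points in (R/2, 2R), the neighbourhood used
  -- for differentiation under the integral.
  set m : ℝ := R / 2 * Real.sin η with hm_def
  have hm : 0 < m := by positivity
  set g' : ℂ → ℂ := fun σ => wrightKernel α θ σ *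
    (((α - 1 : ℝ) : ℂ) * σ⁻¹ + 1 - θ * α * σ ^ ((α - 1 : ℝ) : ℂ)) with hg'
  have hm_le : ∀ x ∈ Ioo (R / 2) (2 * R), ∀ t : ℝ, m ≤ ‖rayPoint η x t‖ := by
    intro x hx t
    refine le_trans ?_ (mul_sin_le_norm_rayPoint_left η x t)
    rw [hm_def]; gcongr; exact hx.1.le
  have hg : ∀ x ∈ Ioo (R / 2) (2 * R), ∀ t : ℝ, 0 ≤ t →
      ‖wrightKernel α θ (rayPoint η x t)‖ ≤
        m ^ (α - 1) * Real.exp (2 * R) * Real.exp (Real.cos η * t) := by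
    intro x hx t ht
    refine (norm_wrightKernel_rayPoint_le hη0 hηπ (by linarith [hx.1]) ht hα hα1 hαη hθ hm
      (hm_le x hx t)).trans ?_
    rw [mul_assoc, ← Real.exp_add]
    gcongr
    have : 0 ≤ θ * (Real.cos (α * η) * m ^ α) := by positivity
    linarith [hx.2]
  have hg'_le : ∀ x ∈ Ioo (R / 2) (2 * R), ∀ t : ℝ, 0 ≤ t →
      ‖g' (rayPoint η x t)‖ ≤ m ^ (α - 1) * Real.exp (2 * R) * (m⁻¹ + 1 + θ * m ^ (α - 1)) *
        Real.exp (Real.cos η * t) := by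
    intro x hx t ht
    have h1 := hm_le x hx t
    rw [hg', norm_mul, mul_right_comm _ _ (Real.exp (Real.cos η * t))]
    refine mul_le_mul (hg x hx t ht) ?_ (norm_nonneg _) (by positivity)
    refine (norm_sub_le _ _).trans (add_le_add ((norm_add_le _ _).trans (add_le_add ?_ ?_)) ?_)
    · rw [norm_mul, norm_inv, Complex.norm_real, Real.norm_eq_abs]
      have : |α - 1| ≤ 1 := by rw [abs_le]; constructor <;> linarith
      calc |α - 1| * ‖rayPoint η x t‖⁻¹ ≤ 1 * m⁻¹ := by gcongr
        _ = m⁻¹ := one_mul _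
    · simp
    · rw [norm_mul, norm_mul, Complex.norm_cpow_real, Complex.norm_real, Complex.norm_real,
        Real.norm_of_nonneg hθ, Real.norm_of_nonneg hα.le]
      have := Real.rpow_le_rpow_of_nonpos hm h1 (by linarith : α - 1 ≤ 0)
      calc θ * α * ‖rayPoint η x t‖ ^ (α - 1) ≤ θ * 1 * m ^ (α - 1) := by gcongr
        _ = _ := by ring
  have hint : IntegrableOn (fun t => Real.exp (Real.cos η * t)) (Ioi 0) :=
    integrableOn_exp_mul_Ioi hc 0
  have hRmem : R ∈ Ioo (R / 2) (2 * R) := ⟨by linarith, by linarith⟩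
  have hg'c : ContinuousOn g' Complex.slitPlane := by
    refine (continuousOn_wrightKernel α θ).mul ?_
    refine ((continuousOn_const.mul (continuousOn_inv₀.mono fun σ hσ =>
      Complex.slitPlane_ne_zero hσ)).add continuousOn_const).sub (continuousOn_const.mul ?_)
    exact fun σ hσ => (continuousAt_cpow_const hσ).continuousWithinAt
  have hmain := hasDerivAt_integral_of_dominated_loc_of_deriv_le
    (μ := volume.restrict (Ioi (0 : ℝ))) (x₀ := R)
    (F := fun (R : ℝ) (t : ℝ) => wrightKernel α θ (rayPoint η R t))
    (F' := fun (R : ℝ) (t : ℝ) => g' (rayPoint η R t))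
    (Ioo_mem_nhds hRmem.1 hRmem.2)
    (Eventually.of_forall fun x =>
      aestronglyMeasurable_comp_rayPoint hη0 hηπ (continuousOn_wrightKernel α θ))
    ((hint.const_mul (m ^ (α - 1) * Real.exp (2 * R))).mono'
      (aestronglyMeasurable_comp_rayPoint hη0 hηπ (continuousOn_wrightKernel α θ))
      ((ae_restrict_mem measurableSet_Ioi).mono fun t ht => hg R hRmem t (le_of_lt ht)))
    (aestronglyMeasurable_comp_rayPoint hη0 hηπ hg'c)
    ((ae_restrict_mem measurableSet_Ioi).mono fun t ht x hx => hg'_le x hx t (le_of_lt ht))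
    (hint.const_mul _)
    ((ae_restrict_mem measurableSet_Ioi).mono fun t ht x hx => by
      have h1 := hasDerivAt_wrightKernel α θ (rayPoint_mem_slitPlane hη0 hηπ (le_of_lt ht)
        (Or.inr ht) (R := x))
      rw [← mul_one (g' _)]
      exact h1.comp x (hasDerivAt_rayPoint_left η x t))
  convert! hmain.2.const_mul (Complex.exp (η * Complex.I)) using 1
  rw [← integral_const_mul]
  -- The factor e^{iη} turns the derivative in R into the derivative in t, so the integral
  -- telescopes to minus the kernel at the starting point R.
  have hd : ∀ t : ℝ, 0 ≤ t → HasDerivAt (fun t => wrightKernel α θ (rayPoint η R t))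
      (Complex.exp (η * Complex.I) * g' (rayPoint η R t)) t := by
    intro t ht
    have h1 := hasDerivAt_wrightKernel α θ (rayPoint_mem_slitPlane hη0 hηπ ht
        (Or.inl hR) (R := R))
    rw [mul_comm]
    exact h1.comp t (hasDerivAt_rayPoint η R t)
  have h := integral_Ioi_of_hasDerivAt_of_tendsto
    (f := fun t => wrightKernel α θ (rayPoint η R t)) (a := 0) (m := 0)
    (hd 0 le_rfl).continuousAt.continuousWithinAt (fun t ht => hd t (le_of_lt ht))
    (hmain.1.const_mul _) ?_
  · rw [h, rayPoint_zero_right, zero_sub]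
  · have h0 : Tendsto (fun t => m ^ (α - 1) * Real.exp (2 * R) * Real.exp (Real.cos η * t))
        atTop (𝓝 (m ^ (α - 1) * Real.exp (2 * R) * 0)) :=
      (Real.tendsto_exp_atBot.comp (tendsto_id.const_mul_atTop_of_neg hc)).const_mul _
    rw [mul_zero] at h0
    refine squeeze_zero_norm' ?_ h0
    filter_upwards [eventually_ge_atTop 0] with t ht using hg R hRmem t ht

theorem wrightKernel_ofReal_im {R : ℝ} (hR : 0 ≤ R) (α θ : ℝ) :
    (wrightKernel α θ R).im = 0 := by
  rw [wrightKernel, ← Complex.ofReal_cpow hR, ← Complex.ofReal_cpow hR]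
  norm_cast

/-- The derivative in R is minus the kernel on the positive axis, which is real. So the imaginary
part is constant for R > 0, and the singular endpoint R = 0 is reached as a limit. -/
theorem im_integral_wrightKernel_eq {η R α θ : ℝ} (hη : Real.pi / 2 < η) (hηπ : η < Real.pi)
    (hR : 0 < R) (hα : 0 < α) (hα1 : α ≤ 1) (hαη : α * η < Real.pi / 2) (hθ : 0 ≤ θ) :
    (Complex.exp (η * Complex.I) *
      ∫ t in Ioi (0 : ℝ), wrightKernel α θ (rayPoint η R t)).im =
    (Complex.exp (η * Complex.I) *
      ∫ t in Ioi (0 : ℝ), wrightKernel α θ (rayPoint η 0 t)).im := by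
  have hη0 : 0 < η := by linarith [Real.pi_pos]
  have hs := Real.sin_pos_of_pos_of_lt_pi hη0 hηπ
  have hc : Real.cos η < 0 := Real.cos_neg_of_pi_div_two_lt_of_lt hη (by linarith)
  have hcα : 0 ≤ Real.cos (α * η) :=
    Real.cos_nonneg_of_neg_pi_div_two_le_of_le (by nlinarith [Real.pi_pos]) hαη.le
  set J : ℝ → ℂ := fun R => Complex.exp (η * Complex.I) *
      ∫ t in Ioi (0 : ℝ), wrightKernel α θ (rayPoint η R t) with hJ
  have hd : ∀ x : ℝ, 0 < x → HasDerivAt (fun x => (J x).im) 0 x := by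
    intro x hx
    have h1 := Complex.imCLM.hasFDerivAt.comp_hasDerivAt x
      (hasDerivAt_integral_wrightKernel hη hηπ hx hα hα1 hαη hθ)
    convert! h1 using 1
    simp [wrightKernel_ofReal_im hx.le]
  have hconst : ∀ x ∈ Ioc 0 R, (J x).im = (J R).im := by
    intro x hx
    refine (constant_of_has_deriv_right_zero (f := fun x => (J x).im) (a := x) (b := R)
      ?_ ?_ R ⟨hx.2, le_rfl⟩).symm
    · exact fun y hy => (hd y (hx.1.trans_le hy.1)).continuousAt.continuousWithinAt
    · exact fun y hy => (hd y (hx.1.trans_le hy.1)).hasDerivWithinAt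
  -- The bound |σ| ≥ R sin η degenerates as R → 0; |σ| ≥ t sin η is uniform in R and leaves the
  -- singularity t^(α-1), integrable since α > 0.
  have hlim : Tendsto J (𝓝[>] 0) (𝓝 (J 0)) := by
    refine Tendsto.const_mul _ ?_
    refine tendsto_integral_filter_of_dominated_convergence
      (fun t => (Real.sin η ^ (α - 1) * Real.exp 1) *
        (t ^ (α - 1) * Real.exp (-(-Real.cos η) * t)))
      (Eventually.of_forall fun x =>
        aestronglyMeasurable_comp_rayPoint hη0 hηπ (continuousOn_wrightKernel α θ))
      ?_ ((integrableOn_rpow_mul_exp_neg_mul (by linarith) (by linarith)).const_mul _) ?_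
    · filter_upwards [Ioo_mem_nhdsGT one_pos] with x hx
      refine (ae_restrict_mem measurableSet_Ioi).mono fun t (ht : 0 < t) => ?_
      refine (norm_wrightKernel_rayPoint_le hη0 hηπ hx.1.le ht.le hα hα1 hαη hθ
        (by positivity) (mul_sin_le_norm_rayPoint η x t)).trans ?_
      rw [Real.mul_rpow ht.le hs.le, mul_mul_mul_comm, ← Real.exp_add,
        mul_comm (t ^ (α - 1))]
      gcongr
      have : 0 ≤ θ * (Real.cos (α * η) * (t * Real.sin η) ^ α) := by positivity
      linarith [hx.2]
    · refine (ae_restrict_mem measurableSet_Ioi).mono fun t (ht : 0 < t) => ?_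
      have h1 := (hasDerivAt_wrightKernel α θ (rayPoint_mem_slitPlane hη0 hηπ ht.le
        (Or.inr ht) (R := 0))).continuousAt
      have h2 := (hasDerivAt_rayPoint_left η 0 t).continuousAt
      exact (ContinuousAt.comp (f := fun x => rayPoint η x t) h1 h2).tendsto.mono_left
        nhdsWithin_le_nhds
  have h1 := (Complex.continuous_im.tendsto _).comp hlim
  refine tendsto_nhds_unique ?_ h1
  refine tendsto_const_nhds.congr' ?_
  filter_upwards [Ioc_mem_nhdsGT hR] with x hx using (hconst x hx).symm

/-! ## The series of the Wright function and its decay -/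

/-- For α < 1 the slope T^(α-1) can be made arbitrarily small, so that exp(θ t^α) can be absorbed
into any decaying exponential. -/
theorem rpow_le_rpow_add_rpow_mul {α t T : ℝ} (hα : 0 < α) (hα1 : α ≤ 1) (ht : 0 < t)
    (hT : 0 < T) : t ^ α ≤ T ^ α + T ^ (α - 1) * t := by
  rcases le_total t T with h | h
  · have := Real.rpow_le_rpow ht.le h hα.le
    have : 0 ≤ T ^ (α - 1) * t := by positivity
    linarith
  · have h1 := Real.rpow_le_rpow_of_nonpos hT h (by linarith : α - 1 ≤ 0)
    have h2 : t ^ α = t ^ (α - 1) * t := by rw [Real.rpow_sub_one ht.ne']; field_simp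
    have : 0 ≤ T ^ α := by positivity
    rw [h2]
    nlinarith

theorem integrableOn_rpow_mul_exp_mul_exp_rpow {α c θ : ℝ} (hα : 0 < α) (hα1 : α < 1)
    (hc : 0 < c) (hθ : 0 ≤ θ) :
    IntegrableOn (fun t : ℝ => t ^ (α - 1) * Real.exp (-c * t) * Real.exp (θ * t ^ α))
      (Ioi 0) := by
  obtain ⟨T, hT, hTc⟩ : ∃ T : ℝ, 0 < T ∧ θ * T ^ (α - 1) ≤ c / 2 := by
    have h1 : Tendsto (fun T : ℝ => θ * T ^ (α - 1)) atTop (𝓝 (θ * 0)) := by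
      have := tendsto_rpow_neg_atTop (y := 1 - α) (by linarith)
      rw [neg_sub] at this
      exact this.const_mul θ
    rw [mul_zero] at h1
    obtain ⟨T, h⟩ := ((eventually_gt_atTop 0).and
      (h1.eventually (eventually_le_nhds (by positivity : 0 < c / 2)))).exists
    exact ⟨T, h⟩
  refine ((integrableOn_rpow_mul_exp_neg_mul (s := α - 1) (c := c / 2) (by linarith)
    (by linarith)).const_mul (Real.exp (θ * T ^ α))).mono' ?_ ?_
  · exact (by fun_prop : Measurable (fun t : ℝ =>
      t ^ (α - 1) * Real.exp (-c * t) * Real.exp (θ * t ^ α))).aestronglyMeasurable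
  · refine (ae_restrict_mem measurableSet_Ioi).mono fun t (ht : 0 < t) => ?_
    rw [Real.norm_of_nonneg (by positivity), mul_left_comm, mul_assoc, ← Real.exp_add,
      ← Real.exp_add]
    refine mul_le_mul_of_nonneg_left (Real.exp_le_exp.2 ?_) (by positivity)
    have h1 := rpow_le_rpow_add_rpow_mul hα hα1.le ht hT
    nlinarith [mul_le_mul_of_nonneg_left h1 hθ]

/-- The function `∑ (-θ)^k / k! * Γ((k+1)α) sin((k+1)πα)` as a contour integral. -/
theorem hasSum_wright {η α θ : ℝ} (hη : Real.pi / 2 < η) (hηπ : η < Real.pi)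
    (hα : 0 < α) (hα1 : α < 1) (hθ : 0 ≤ θ) :
    HasSum (fun k : ℕ => (-1 : ℝ) ^ k * θ ^ k / k.factorial *
        Real.Gamma (((k : ℝ) + 1) * α) * Real.sin (((k : ℝ) + 1) * Real.pi * α))
      (Complex.exp (η * Complex.I) *
        ∫ t in Ioi (0 : ℝ), wrightKernel α θ (rayPoint η 0 t)).im := by
  have hc : Real.cos η < 0 := Real.cos_neg_of_pi_div_two_lt_of_lt hη (by linarith)
  set d : ℂ := Complex.exp (η * Complex.I) with hd
  have hdre : d.re = Real.cos η := Complex.exp_ofReal_mul_I_re η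
  have hr : 0 < (-d).re := by rw [Complex.neg_re, hdre]; linarith
  have hpow : ∀ t : ℝ, 0 < t → ∀ a : ℝ, rayPoint η 0 t ^ (a : ℂ) =
      ((t ^ a : ℝ) : ℂ) * Complex.exp (η * a * Complex.I) := by
    intro t ht a
    have hlog : Complex.log d = η * Complex.I := by
      rw [hd, Complex.log_exp] <;> simp <;> linarith [Real.pi_pos]
    have hd0 : d ≠ 0 := Complex.exp_ne_zero _
    rw [rayPoint, Complex.ofReal_zero, zero_add, ← hd,
      Complex.cpow_def_of_ne_zero (mul_ne_zero (Complex.ofReal_ne_zero.2 ht.ne') hd0),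
      Complex.log_ofReal_mul ht hd0, hlog, Real.rpow_def_of_pos ht, Complex.ofReal_exp,
      ← Complex.exp_add]
    congr 1
    push_cast
    ring
  -- Euler's integral applies with r = -d, which lies in the right half plane and has argument η -
  -- π. The phases combine to e^{iπa}, independent of η; its imaginary part will be the sine of the
  -- series.
  have hgamma : ∀ a : ℝ, 0 < a → Complex.exp (η * a * Complex.I) *
      ∫ t in Ioi (0 : ℝ), ((t ^ (a - 1) : ℝ) : ℂ) * Complex.exp (d * t) =
      Real.Gamma a * Complex.exp (a * Real.pi * Complex.I) := by
    intro a ha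
    have h1 := integral_rpow_mul_cexp_neg_mul_Ioi ha hr
    have h2 : (-d) ^ (a : ℂ) = Complex.exp ((η - Real.pi) * a * Complex.I) := by
      have : -d = Complex.exp (((η - Real.pi : ℝ) : ℂ) * Complex.I) := by
        rw [hd]; push_cast; rw [sub_mul, Complex.exp_sub, Complex.exp_pi_mul_I, div_neg, div_one]
      rw [this, Complex.cpow_def_of_ne_zero (Complex.exp_ne_zero _), Complex.log_exp]
      · push_cast; congr 1; ring
      · simp; linarith [Real.pi_pos]
      · simp; linarith [Real.pi_pos]
    rw [← h1, h2, mul_right_comm _ _ (Complex.exp (a * Real.pi * Complex.I)), ← Complex.exp_add]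
    simp only [neg_mul, neg_neg]
    congr 2
    ring
  -- The k-th term of the expansion of exp(-θσ^α) on the ray, with dσ = d dt included. The norms sum
  -- to t^(α-1) e^{t cos η} exp(θ t^α), which is integrable as α < 1.
  set F : ℕ → ℝ → ℂ := fun k t => d * (((-θ : ℝ) : ℂ) ^ k / k.factorial) *
    Complex.exp (η * (((k : ℝ) + 1) * α - 1 : ℝ) * Complex.I) *
      (((t ^ (((k : ℝ) + 1) * α - 1) : ℝ) : ℂ) * Complex.exp (d * t)) with hF
  have hsum : HasSum (fun k => ∫ t in Ioi (0 : ℝ), F k t)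
      (∫ t in Ioi (0 : ℝ), d * wrightKernel α θ (rayPoint η 0 t)) := by
    have hbd : ∀ t : ℝ, HasSum (fun k : ℕ => t ^ (α - 1) * Real.exp (-(-Real.cos η) * t) *
        ((θ * t ^ α) ^ k / k.factorial))
        (t ^ (α - 1) * Real.exp (-(-Real.cos η) * t) * Real.exp (θ * t ^ α)) := by
      intro t
      have := NormedSpace.expSeries_div_hasSum_exp (θ * t ^ α)
      rw [← Real.exp_eq_exp_ℝ] at this
      exact this.mul_left _
    refine hasSum_integral_of_dominated_convergence
      (fun k t => t ^ (α - 1) * Real.exp (-(-Real.cos η) * t) *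
        ((θ * t ^ α) ^ k / k.factorial)) ?_ ?_ (Eventually.of_forall fun t => (hbd t).summable)
      ?_ ?_
    · exact fun k => (by fun_prop : Measurable (F k)).aestronglyMeasurable
    · intro k
      refine (ae_restrict_mem measurableSet_Ioi).mono fun t (ht : 0 < t) => le_of_eq ?_
      have e1 : ‖Complex.exp (η * (((k : ℝ) + 1) * α - 1 : ℝ) * Complex.I)‖ = 1 := by
        rw [← Complex.ofReal_mul, Complex.norm_exp_ofReal_mul_I]
      have e2 : ‖d‖ = 1 := Complex.norm_exp_ofReal_mul_I η
      have e3 : ‖Complex.exp (d * t)‖ = Real.exp (-(-Real.cos η) * t) := by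
        rw [Complex.norm_exp, Complex.re_mul_ofReal, hdre, neg_neg]
      have e4 : t ^ (((k : ℝ) + 1) * α - 1) = t ^ (α - 1) * (t ^ α) ^ k := by
        rw [← Real.rpow_mul_natCast ht.le, ← Real.rpow_add ht]; congr 1; ring
      rw [hF, norm_mul, norm_mul, norm_mul, norm_mul, e1, e2, e3, Complex.norm_real,
        Real.norm_of_nonneg (by positivity), e4, norm_div, norm_pow, Complex.norm_real, norm_neg,
        Real.norm_of_nonneg hθ, Complex.norm_natCast, mul_pow]
      ring
    · simp_rw [fun t => (hbd t).tsum_eq]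
      exact integrableOn_rpow_mul_exp_mul_exp_rpow hα hα1 (by linarith) hθ
    · refine (ae_restrict_mem measurableSet_Ioi).mono fun t (ht : 0 < t) => ?_
      have h1 := NormedSpace.expSeries_div_hasSum_exp (-(θ * rayPoint η 0 t ^ (α : ℂ)))
      rw [← Complex.exp_eq_exp_ℂ] at h1
      have h2 := h1.mul_left (d * (rayPoint η 0 t ^ ((α - 1 : ℝ) : ℂ) * Complex.exp (d * t)))
      convert! h2 using 1
      · ext k
        rw [hF, hpow t ht, hpow t ht]
        have e4 : t ^ (((k : ℝ) + 1) * α - 1) = t ^ (α - 1) * (t ^ α) ^ k := by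
          rw [← Real.rpow_mul_natCast ht.le, ← Real.rpow_add ht]; congr 1; ring
        have e5 : Complex.exp (η * (((k : ℝ) + 1) * α - 1 : ℝ) * Complex.I) =
            Complex.exp (η * (α - 1 : ℝ) * Complex.I) * Complex.exp (η * α * Complex.I) ^ k := by
          rw [← Complex.exp_nat_mul, ← Complex.exp_add]; congr 1; push_cast; ring
        have e6 : (-(θ * (((t ^ α : ℝ) : ℂ) * Complex.exp (η * α * Complex.I)))) ^ k =
            ((-θ : ℝ) : ℂ) ^ k * (((t ^ α : ℝ) : ℂ) ^ k * Complex.exp (η * α * Complex.I) ^ k) := by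
          rw [← mul_pow, ← mul_pow]; congr 1; push_cast; ring
        simp only [e4, e5, e6]
        push_cast
        ring
      · rw [wrightKernel, sub_eq_add_neg (rayPoint η 0 t), Complex.exp_add]
        have : rayPoint η 0 t = d * t := by simp [rayPoint, hd, mul_comm]
        rw [← this]
        ring
  rw [integral_const_mul] at hsum
  convert! Complex.hasSum_im hsum using 1
  ext k
  have ha : 0 < ((k : ℝ) + 1) * α := by positivity
  have e1 : d * Complex.exp (η * (((k : ℝ) + 1) * α - 1 : ℝ) * Complex.I) =
      Complex.exp (η * (((k : ℝ) + 1) * α : ℝ) * Complex.I) := by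
    rw [hd, ← Complex.exp_add]; congr 1; push_cast; ring
  have e2 : ∫ t in Ioi (0 : ℝ), F k t = (((-θ) ^ k / k.factorial *
      Real.Gamma (((k : ℝ) + 1) * α) : ℝ) : ℂ) *
        Complex.exp (((((k : ℝ) + 1) * Real.pi * α : ℝ) : ℂ) * Complex.I) := by
    rw [hF, integral_const_mul, mul_right_comm d, e1, mul_right_comm, hgamma _ ha]
    have : (((k : ℝ) + 1) * α : ℝ) * Real.pi * Complex.I =
      ((((k : ℝ) + 1) * Real.pi * α : ℝ) : ℂ) * Complex.I := by push_cast; ring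
    rw [this]
    push_cast
    ring
  rw [e2, Complex.im_ofReal_mul, Complex.exp_ofReal_mul_I_im, neg_pow θ]

/-- The powers of θ collapse to θ^k, and Γ(x+1) = xΓ(x) with x = (k+1)α cancels both 1/α and the
factor k+1 of (k+1)!. -/
theorem phi_eq {α θ : ℝ} (hα : 0 < α) (hθ : 0 < θ) :
    RegionalControl.phi α θ = Real.pi⁻¹ * ∑' k : ℕ, (-1 : ℝ) ^ k * θ ^ k / k.factorial *
        Real.Gamma (((k : ℝ) + 1) * α) * Real.sin (((k : ℝ) + 1) * Real.pi * α) := by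
  rw [RegionalControl.phi, RegionalControl.psi, mul_left_comm, one_div Real.pi, ← tsum_mul_left]
  congr 2
  ext k
  have ha : ((k : ℝ) + 1) * α ≠ 0 := by positivity
  have e1 : (θ ^ (-1 / α)) ^ (-α * ((k : ℝ) + 1) - 1) = θ ^ k * θ * θ ^ (1 / α) := by
    rw [← Real.rpow_mul hθ.le, ← Real.rpow_natCast, ← Real.rpow_add_one hθ.ne',
      ← Real.rpow_add hθ]
    congr 1
    field_simp
    ring
  have e2 : θ ^ (-1 - 1 / α) = θ⁻¹ * (θ ^ (1 / α))⁻¹ := by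
    rw [Real.rpow_sub hθ, Real.rpow_neg_one]; rfl
  have h3 : θ ^ (1 / α) ≠ 0 := by positivity
  rw [e1, e2, Real.Gamma_add_one ha, Nat.factorial_succ]
  push_cast
  field_simp

/-- A direction `e^{iη}` in the left half plane with `e^{iηα}` in the right half plane. -/
theorem exists_direction {α : ℝ} (hα : 0 < α) (hα1 : α < 1) :
    ∃ η : ℝ, Real.pi / 2 < η ∧ η < Real.pi ∧ α * η < Real.pi / 2 := by
  have hp := Real.pi_pos
  have h : Real.pi / 2 < min Real.pi (Real.pi / 2 / α) := by
    refine lt_min (by linarith) ?_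
    rw [lt_div_iff₀ hα]; nlinarith
  obtain ⟨η, h1, h2⟩ := exists_between h
  refine ⟨η, h1, h2.trans_le (min_le_left _ _), ?_⟩
  have := h2.trans_le (min_le_right _ _)
  rwa [lt_div_iff₀ hα, mul_comm] at this

theorem phi_aestronglyMeasurable {α : ℝ} (hα : 0 < α) (hα1 : α < 1) :
    AEStronglyMeasurable (RegionalControl.phi α) (volume.restrict (Ioi 0)) := by
  obtain ⟨η, h1, h2, h3⟩ := exists_direction hα hα1
  refine aestronglyMeasurable_of_tendsto_ae atTop
    (f := fun n θ => Real.pi⁻¹ * ∑ k ∈ Finset.range n, (-1 : ℝ) ^ k * θ ^ k / k.factorial *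
        Real.Gamma (((k : ℝ) + 1) * α) * Real.sin (((k : ℝ) + 1) * Real.pi * α)) ?_ ?_
  · exact fun n => (by fun_prop : Continuous fun θ : ℝ => Real.pi⁻¹ *
      ∑ k ∈ Finset.range n, (-1 : ℝ) ^ k * θ ^ k / k.factorial * Real.Gamma (((k : ℝ) + 1) * α) *
        Real.sin (((k : ℝ) + 1) * Real.pi * α)).aestronglyMeasurable
  · refine (ae_restrict_mem measurableSet_Ioi).mono fun θ (hθ : 0 < θ) => ?_
    rw [phi_eq hα hθ]
    have h := hasSum_wright h1 h2 hα hα1 hθ.le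
    exact (h.summable.hasSum.tendsto_sum_nat).const_mul _

/-- The function `φ_α` decays faster than every exponential. -/
theorem abs_phi_le {α : ℝ} (hα : 0 < α) (hα1 : α < 1) (w : ℝ) :
    ∃ C : ℝ, ∀ θ : ℝ, 0 < θ → |RegionalControl.phi α θ| ≤ C * Real.exp (-w * θ) := by
  obtain ⟨η, hη, hηπ, hαη⟩ := exists_direction hα hα1
  have hη0 : 0 < η := by linarith [Real.pi_pos]
  have hs := Real.sin_pos_of_pos_of_lt_pi hη0 hηπ
  have hc : Real.cos η < 0 := Real.cos_neg_of_pi_div_two_lt_of_lt hη (by linarith)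
  have hcα : 0 < Real.cos (α * η) :=
    Real.cos_pos_of_mem_Ioo ⟨by nlinarith [Real.pi_pos], hαη⟩
  -- The kernel decays in θ at rate cos(αη) m^α, which reaches `w` for large `m` since cos(αη) > 0.
  -- Taking R = m / sin η keeps the ray at distance at least `m` from 0; the price e^R does not
  -- depend on θ.
  obtain ⟨m, hm, hmw⟩ : ∃ m : ℝ, 0 < m ∧ w ≤ Real.cos (α * η) * m ^ α := by
    have h := ((tendsto_rpow_atTop hα).const_mul_atTop hcα).eventually_ge_atTop w
    exact ((eventually_gt_atTop 0).and h).exists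
  set R : ℝ := m / Real.sin η with hR_def
  have hR : 0 < R := by positivity
  have hint : IntegrableOn (fun t => Real.exp (Real.cos η * t)) (Ioi 0) :=
    integrableOn_exp_mul_Ioi hc 0
  refine ⟨Real.pi⁻¹ * (m ^ (α - 1) * Real.exp R * ∫ t in Ioi (0 : ℝ), Real.exp (Real.cos η * t)),
    fun θ hθ => ?_⟩
  rw [phi_eq hα hθ, (hasSum_wright hη hηπ hα hα1 hθ.le).tsum_eq,
    ← im_integral_wrightKernel_eq hη hηπ hR hα hα1.le hαη hθ.le, abs_mul,
    abs_of_pos (by positivity : 0 < Real.pi⁻¹), mul_assoc]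
  gcongr
  refine (Complex.abs_im_le_norm _).trans ?_
  rw [norm_mul, Complex.norm_exp_ofReal_mul_I, one_mul, mul_right_comm, ← integral_const_mul]
  refine norm_integral_le_of_norm_le (hint.const_mul _) ?_
  refine (ae_restrict_mem measurableSet_Ioi).mono fun t (ht : 0 < t) => ?_
  have hmσ : m ≤ ‖rayPoint η R t‖ := by
    refine le_trans (le_of_eq ?_) (mul_sin_le_norm_rayPoint_left η R t)
    rw [hR_def]; field_simp
  refine (norm_wrightKernel_rayPoint_le hη0 hηπ hR.le ht.le hα hα1.le hαη hθ.le hm hmσ).trans ?_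
  rw [mul_assoc, mul_assoc, ← Real.exp_add, ← Real.exp_add]
  gcongr
  nlinarith

/-! ## Integrals depending linearly on a parameter -/

/-- A closed graph criterion for the integral of a family of functions that depends linearly on a
parameter. -/
theorem exists_continuousLinearMap_integral {E Z Y : Type*} [NormedAddCommGroup E]
    [NormedSpace ℝ E] [CompleteSpace E] [NormedAddCommGroup Z] [NormedSpace ℝ Z] [CompleteSpace Z]
    [MeasurableSpace Y] {μ : Measure Y} {f : E → Y → Z} (hi : ∀ x, Integrable (f x) μ)
    (hadd : ∀ x y, f (x + y) =ᵐ[μ] f x + f y) (hsmul : ∀ (c : ℝ) x, f (c • x) =ᵐ[μ] c • f x)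
    (hlim : ∀ (u : ℕ → E) (x : E), Tendsto u atTop (𝓝 x) → ∃ ns : ℕ → ℕ, StrictMono ns ∧
      ∀ᵐ a ∂μ, Tendsto (fun n => f (u (ns n)) a) atTop (𝓝 (f x a))) :
    ∃ T : E →L[ℝ] Z, ∀ x, T x = ∫ a, f x a ∂μ := by
  let L : E →ₗ[ℝ] Lp Z 1 μ :=
    { toFun := fun x => (hi x).toL1 _
      map_add' := fun x y => by
        rw [← Integrable.toL1_add, Integrable.toL1_eq_toL1_iff]
        exact hadd x y
      map_smul' := fun c x => by
        rw [RingHom.id_apply, ← Integrable.toL1_smul', Integrable.toL1_eq_toL1_iff]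
        exact hsmul c x }
  have hL : Continuous L := by
    -- A limit in L¹ and the pointwise limit from `hlim` must agree a.e. along a common subsequence.
    refine L.continuous_of_seq_closed_graph fun u x y hu hy => ?_
    obtain ⟨ns, hns, hns_lim⟩ := hlim u x hu
    obtain ⟨ms, hms, hae⟩ := (tendstoInMeasure_of_tendsto_Lp
      (hy.comp hns.tendsto_atTop)).exists_seq_tendsto_ae
    refine Lp.ext ?_
    have h1 := ae_all_iff.2 fun n => (hi (u (ns (ms n)))).coeFn_toL1
    filter_upwards [hae, h1, (hi x).coeFn_toL1, hns_lim] with a h2 h1 h3 h4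
    refine (tendsto_nhds_unique h2 ?_).trans h3.symm
    exact (h4.comp hms.tendsto_atTop).congr fun n => (h1 n).symm
  refine ⟨(L1.integralCLM (E := Z)).comp ⟨L, hL⟩, fun x => ?_⟩
  exact (L1.integral_eq _).symm.trans (integral_eq _ (hi x)).symm

/-! ## Strongly continuous semigroups and the operators `K_α(t)` -/

namespace RegionalControl

variable {Z : Type*} [NormedAddCommGroup Z] [NormedSpace ℝ Z]

namespace C0Semigroup

theorem tendsto_zero_Ici (Φ : C0Semigroup Z) (z : Z) :
    Tendsto (fun t => Φ.toFun t z) (𝓝[≥] 0) (𝓝 z) := by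
  rw [← Ioi_insert, nhdsWithin_insert, tendsto_sup]
  refine ⟨?_, Φ.tendsto_zero z⟩
  rw [tendsto_pure_left]
  intro s hs
  rw [Φ.map_zero]
  exact mem_of_mem_nhds hs

/-- Otherwise there are t_n → 0 with ‖Φ(t_n)‖ > n, although Φ(t_n)z converges for every z, against
Banach–Steinhaus. -/
theorem exists_norm_le_near_zero [CompleteSpace Z] (Φ : C0Semigroup Z) :
    ∃ δ > 0, ∃ M : ℝ, ∀ t ∈ Icc 0 δ, ‖Φ.toFun t‖ ≤ M := by
  by_contra! h
  choose t ht hM using fun n : ℕ => h (1 / ((n : ℝ) + 1)) (by positivity) n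
  have h0 : Tendsto t atTop (𝓝[≥] 0) :=
    tendsto_nhdsWithin_iff.2 ⟨squeeze_zero (fun n => (ht n).1) (fun n => (ht n).2)
      tendsto_one_div_add_atTop_nhds_zero_nat, Eventually.of_forall fun n => (ht n).1⟩
  obtain ⟨C, hC⟩ := banach_steinhaus (g := fun n => Φ.toFun (t n)) fun z => by
    obtain ⟨C, hC⟩ := ((Φ.tendsto_zero_Ici z).comp h0).norm.bddAbove_range
    exact ⟨C, fun n => hC ⟨n, rfl⟩⟩
  obtain ⟨n, hn⟩ := exists_nat_gt C
  linarith [hC n, hM n]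

/-- Exponential growth bound. -/
theorem exists_norm_le_exp [CompleteSpace Z] (Φ : C0Semigroup Z) :
    ∃ M w : ℝ, 0 ≤ M ∧ 0 ≤ w ∧ ∀ t : ℝ, 0 ≤ t → ‖Φ.toFun t‖ ≤ M * Real.exp (w * t) := by
  obtain ⟨δ, hδ, M, hM⟩ := Φ.exists_norm_le_near_zero
  set N : ℝ := max M 1 with hN
  have hN1 : 1 ≤ N := le_max_right _ _
  have hind : ∀ n : ℕ, ∀ t : ℝ, 0 ≤ t → t ≤ (n + 1) * δ → ‖Φ.toFun t‖ ≤ N ^ (n + 1) := by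
    intro n
    induction n with
    | zero =>
      intro t ht h
      rw [zero_add, pow_one]
      exact (hM t ⟨ht, by simpa using h⟩).trans (le_max_left _ _)
    | succ n ih =>
      intro t ht h
      rcases le_total t δ with h1 | h1
      · exact ((hM t ⟨ht, h1⟩).trans (le_max_left _ _)).trans
          (le_self_pow₀ hN1 (by omega))
      · have e : t = δ + (t - δ) := by ring
        rw [e, Φ.map_add _ _ hδ.le (by linarith), pow_succ']
        refine (ContinuousLinearMap.opNorm_comp_le _ _).trans ?_
        refine mul_le_mul ((hM δ ⟨hδ.le, le_rfl⟩).trans (le_max_left _ _))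
          (ih _ (by linarith) ?_) (norm_nonneg _) (by positivity)
        push_cast at h
        linarith
  -- Cutting [0, t] into ⌊t/δ⌋ + 1 pieces of length at most δ gives N · N^(t/δ); N ≥ 1 makes the
  -- powers monotone.
  refine ⟨N, Real.log N / δ, by positivity, by have := Real.log_nonneg hN1; positivity,
    fun t ht => ?_⟩
  refine (hind ⌊t / δ⌋₊ t ht ?_).trans ?_
  · rw [← div_le_iff₀ hδ]; exact (Nat.lt_floor_add_one _).le
  · rw [pow_succ', div_mul_eq_mul_div, mul_div_assoc, ← Real.rpow_def_of_pos (by positivity),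
      ← Real.rpow_natCast]
    gcongr
    exact Nat.floor_le (by positivity)

/-- Both one-sided limits reduce to continuity at 0 by Φ(t) - Φ(s) = Φ(s)(Φ(t-s) - I) for s ≤ t,
with the growth bound controlling the outer factor; hence the use of |t - s| below. -/
theorem continuousOn [CompleteSpace Z] (Φ : C0Semigroup Z) (z : Z) :
    ContinuousOn (fun t => Φ.toFun t z) (Ici 0) := by
  obtain ⟨M, w, hM, hw, hΦ⟩ := Φ.exists_norm_le_exp
  have key : ∀ s t : ℝ, 0 ≤ s → s ≤ t → ‖Φ.toFun t z - Φ.toFun s z‖ ≤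
      M * Real.exp (w * s) * ‖Φ.toFun (t - s) z - z‖ := by
    intro s t hs hst
    have e : Φ.toFun t z = Φ.toFun s (Φ.toFun (t - s) z) := by
      rw [← ContinuousLinearMap.comp_apply, ← Φ.map_add _ _ hs (by linarith), add_sub_cancel]
    rw [e, ← map_sub]
    exact ((Φ.toFun s).le_opNorm _).trans (by gcongr; exact hΦ s hs)
  intro s (hs : 0 ≤ s)
  rw [ContinuousWithinAt, tendsto_iff_norm_sub_tendsto_zero]
  have h1 : Tendsto (fun t => |t - s|) (𝓝[≥] s ⊔ 𝓝[≤] s) (𝓝[≥] 0) := by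
    refine tendsto_nhdsWithin_iff.2 ⟨?_, Eventually.of_forall fun t => mem_Ici.2 (abs_nonneg _)⟩
    have : Tendsto (fun t : ℝ => |t - s|) (𝓝 s) (𝓝 |s - s|) :=
      (by fun_prop : Continuous fun t : ℝ => |t - s|).tendsto s
    rw [sub_self, abs_zero] at this
    exact this.mono_left (sup_le nhdsWithin_le_nhds nhdsWithin_le_nhds)
  have h2 : Tendsto (fun t => |t - s|) (𝓝[Ici 0] s) (𝓝[≥] 0) := by
    refine h1.mono_left ?_
    rw [← nhdsWithin_union, Ici_union_Iic]
    exact nhdsWithin_mono _ (subset_univ _)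
  have h3 : Tendsto (fun t => M * Real.exp (w * s) * ‖Φ.toFun |t - s| z - z‖) (𝓝[Ici 0] s)
      (𝓝 (M * Real.exp (w * s) * 0)) := by
    refine Tendsto.const_mul _ ?_
    exact tendsto_iff_norm_sub_tendsto_zero.1 ((Φ.tendsto_zero_Ici z).comp h2)
  rw [mul_zero] at h3
  refine squeeze_zero' (Eventually.of_forall fun t => norm_nonneg _) ?_ h3
  filter_upwards [self_mem_nhdsWithin] with t (ht : 0 ≤ t)
  rcases le_total s t with h | h
  · rw [abs_of_nonneg (by linarith)]
    exact key s t hs h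
  · rw [abs_of_nonpos (by linarith), neg_sub, norm_sub_rev]
    refine (key t s ht h).trans ?_
    gcongr

end C0Semigroup

theorem integrableOn_phi_smul [CompleteSpace Z] (Φ : C0Semigroup Z) {α t : ℝ} (hα : 0 < α)
    (hα1 : α < 1) (ht : 0 ≤ t) (z : Z) :
    IntegrableOn (fun θ => (θ * phi α θ) • Φ.toFun (t ^ α * θ) z) (Ioi 0) := by
  obtain ⟨M, w, hM, hw, hΦ⟩ := Φ.exists_norm_le_exp
  -- The rate w t^α cancels the growth of Φ(t^α θ), and the extra 1 leaves the integrable majorant θ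
  -- e^{-θ}.
  obtain ⟨C, hC⟩ := abs_phi_le hα hα1 (w * t ^ α + 1)
  have hint : IntegrableOn (fun θ : ℝ => C * M * ‖z‖ * (θ ^ (1 : ℝ) * Real.exp (-1 * θ))) (Ioi 0) :=
    (integrableOn_rpow_mul_exp_neg_mul (by norm_num) one_pos).const_mul _
  refine hint.mono' ?_ ?_
  · refine AEStronglyMeasurable.smul (measurable_id.aestronglyMeasurable.mul
      (phi_aestronglyMeasurable hα hα1)) ?_
    refine ContinuousOn.aestronglyMeasurable ?_ measurableSet_Ioi
    refine (Φ.continuousOn z).comp (by fun_prop) fun θ (hθ : 0 < θ) => ?_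
    exact mul_nonneg (by positivity) hθ.le
  · refine (ae_restrict_mem measurableSet_Ioi).mono fun θ (hθ : 0 < θ) => ?_
    rw [norm_smul, norm_mul, Real.norm_of_nonneg hθ.le, Real.norm_eq_abs, Real.rpow_one]
    have h1 := hC θ hθ
    have h2 : ‖Φ.toFun (t ^ α * θ) z‖ ≤ M * Real.exp (w * (t ^ α * θ)) * ‖z‖ :=
      ((Φ.toFun _).le_opNorm _).trans (by gcongr; exact hΦ _ (by positivity))
    calc θ * |phi α θ| * ‖Φ.toFun (t ^ α * θ) z‖
        ≤ θ * (C * Real.exp (-(w * t ^ α + 1) * θ)) *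
          (M * Real.exp (w * (t ^ α * θ)) * ‖z‖) := by
          have := (abs_nonneg _).trans h1
          gcongr
      _ = C * M * ‖z‖ * (θ * (Real.exp (-(w * t ^ α + 1) * θ) * Real.exp (w * (t ^ α * θ)))) := by
          ring
      _ = _ := by rw [← Real.exp_add]; congr 4; ring

/-- For `t ≥ 0` the operator `K_α(t)` is linear and bounded. -/
theorem exists_continuousLinearMap_K [CompleteSpace Z] (Φ : C0Semigroup Z) {α t : ℝ}
    (hα : 0 < α) (hα1 : α ≤ 1) (ht : 0 ≤ t) : ∃ T : Z →L[ℝ] Z, ∀ z, T z = K Φ α t z := by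
  rcases hα1.eq_or_lt with rfl | hα1
  · exact ⟨Φ.toFun t, fun z => by simp [K]⟩
  have hi := integrableOn_phi_smul Φ hα hα1 ht
  obtain ⟨T, hT⟩ := exists_continuousLinearMap_integral hi
    (fun x y => Eventually.of_forall fun θ => by simp)
    (fun c x => Eventually.of_forall fun θ => by simp [smul_comm c])
    (fun u x hu => ⟨id, strictMono_id, Eventually.of_forall fun θ =>
      (((Φ.toFun _).continuous.tendsto x).comp hu).const_smul _⟩)
  exact ⟨α • T, fun z => by rw [K, if_neg hα1.ne, ← hT]; rfl⟩

end RegionalControl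

namespace RegionalControl

/-- If the defining integral of `H` always converges, then `H` is given by it and bounded. -/
theorem isControlOperator_H {Z : Type*} [NormedAddCommGroup Z] [NormedSpace ℝ Z] [CompleteSpace Z]
    {p : ℕ} (Φ : C0Semigroup Z) {α : ℝ} (hα : 0 < α) (hα1 : α ≤ 1)
    (B : EuclideanSpace ℝ (Fin p) →L[ℝ] Z) (b : ℝ)
    (hH : ∀ u : Controls p b, IntegrableOn (controlIntegrand Φ α B u b) (Ioo 0 b)) :
    IsControlOperator Φ α B b (H Φ α B b) := by
  -- For fixed s the integrand depends on u only through u(s), by a bounded operator: linearity and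
  -- limits can be checked a.e. in s.
  have hK : ∀ s ∈ Ioo 0 b, ∃ T : EuclideanSpace ℝ (Fin p) →L[ℝ] Z, ∀ v,
      T v = (b - s) ^ (α - 1) • K Φ α (b - s) (B v) := by
    intro s hs
    obtain ⟨T, hT⟩ := exists_continuousLinearMap_K Φ hα hα1 (sub_nonneg.2 hs.2.le)
    exact ⟨(b - s) ^ (α - 1) • (T ∘L B), fun v => by simp [hT]⟩
  have hmem : ∀ᵐ s ∂(volume.restrict (Ioo 0 b)), s ∈ Ioo 0 b := ae_restrict_mem measurableSet_Ioo
  have hex : ∃ T : Controls p b →L[ℝ] Z, IsControlOperator Φ α B b T := by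
    refine exists_continuousLinearMap_integral hH ?_ ?_ ?_
    · intro u v
      filter_upwards [hmem, Lp.coeFn_add u v] with s hs h
      obtain ⟨T, hT⟩ := hK s hs
      simp only [controlIntegrand, Pi.add_apply]
      rw [h, ← hT, ← hT, ← hT, Pi.add_apply, map_add]
    · intro c u
      filter_upwards [hmem, Lp.coeFn_smul c u] with s hs h
      obtain ⟨T, hT⟩ := hK s hs
      simp only [controlIntegrand, Pi.smul_apply]
      rw [h, ← hT, ← hT, Pi.smul_apply, map_smul]
    · intro u v huv
      obtain ⟨ns, hns, hae⟩ := (tendstoInMeasure_of_tendsto_Lp huv).exists_seq_tendsto_ae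
      refine ⟨ns, hns, ?_⟩
      filter_upwards [hmem, hae] with s hs h
      obtain ⟨T, hT⟩ := hK s hs
      simp only [controlIntegrand]
      simp_rw [← hT]
      exact (T.continuous.tendsto _).comp h
  rw [H, dif_pos hex]
  exact hex.choose_spec

end RegionalControl

/-! ## Surjectivity and lower bounds for the adjoint -/

/-- If T is onto, the open mapping theorem gives a preimage x of z with ‖x‖ ≤ C‖z‖, and ‖z‖² = ⟨T*z,
x⟩. Conversely ‖z‖² ≤ c²‖T*z‖² = c²⟨TT*z, z⟩ makes TT* bounded below, so its range is closed; it is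
dense since z orthogonal to it has T*z = 0. Thus TT* is already onto. -/
theorem ContinuousLinearMap.surjective_iff_exists_norm_le_adjoint {E F : Type*}
    [NormedAddCommGroup E] [InnerProductSpace ℝ E] [CompleteSpace E] [NormedAddCommGroup F]
    [InnerProductSpace ℝ F] [CompleteSpace F] (T : E →L[ℝ] F) :
    Function.Surjective T ↔ ∃ c : ℝ, 0 < c ∧ ∀ z, ‖z‖ ≤ c * ‖adjoint T z‖ := by
  constructor
  · intro h
    obtain ⟨C, hC, hpre⟩ := T.exists_preimage_norm_le h
    refine ⟨C, hC, fun z => ?_⟩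
    rcases (norm_nonneg z).eq_or_lt with hz | hz
    · rw [← hz]; positivity
    obtain ⟨x, hx, hxz⟩ := hpre z
    have h1 : ‖z‖ * ‖z‖ ≤ ‖adjoint T z‖ * (C * ‖z‖) := by
      calc ‖z‖ * ‖z‖ = inner ℝ z (T x) := by rw [hx, real_inner_self_eq_norm_mul_norm]
        _ = inner ℝ (adjoint T z) x := (adjoint_inner_left T x z).symm
        _ ≤ ‖adjoint T z‖ * ‖x‖ := real_inner_le_norm _ _
        _ ≤ _ := by gcongr
    nlinarith
  · rintro ⟨c, hc, h⟩
    have hanti : AntilipschitzWith ⟨c ^ 2, by positivity⟩ (T ∘L adjoint T) := by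
      refine AddMonoidHomClass.antilipschitz_of_bound _ fun z => ?_
      rcases (norm_nonneg z).eq_or_lt with hz | hz
      · rw [← hz]; exact mul_nonneg (sq_nonneg c) (norm_nonneg _)
      have h1 : ‖adjoint T z‖ * ‖adjoint T z‖ ≤ ‖T (adjoint T z)‖ * ‖z‖ := by
        rw [← real_inner_self_eq_norm_mul_norm, adjoint_inner_left, real_inner_comm]
        exact real_inner_le_norm _ _
      have h2 : ‖z‖ * ‖z‖ ≤ c ^ 2 * (‖adjoint T z‖ * ‖adjoint T z‖) := by
        have := mul_le_mul (h z) (h z) hz.le (by positivity)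
        linarith
      have h3 : ‖z‖ * ‖z‖ ≤ c ^ 2 * ‖T (adjoint T z)‖ * ‖z‖ := by nlinarith [sq_nonneg c]
      exact le_of_mul_le_mul_right h3 hz
    have hclosed : IsClosed (T ∘L adjoint T).range.carrier :=
      hanti.isClosed_range (T ∘L adjoint T).uniformContinuous
    have hbot : (T ∘L adjoint T).rangeᗮ = ⊥ := by
      rw [Submodule.eq_bot_iff]
      intro z hz
      have h0 : inner ℝ (T (adjoint T z)) z = 0 := hz _ ⟨z, rfl⟩
      rw [← adjoint_inner_right, inner_self_eq_zero] at h0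
      have := h z
      rw [h0, norm_zero, mul_zero] at this
      exact norm_le_zero_iff.1 this
    have htop : (T ∘L adjoint T).range = ⊤ := by
      have : CompleteSpace ((T ∘L adjoint T).range) := hclosed.completeSpace_coe
      exact Submodule.orthogonal_eq_bot_iff.1 hbot
    intro z
    obtain ⟨x, hx⟩ := LinearMap.range_eq_top.1 htop z
    exact ⟨_, hx⟩

/-! ### The equivalence of the four properties -/

open RegionalControl in
theorem proposition1 {n p : ℕ} (Ω : Set (EuclideanSpace ℝ (Fin n)))
    (hΩ : IsSmoothBoundedDomain Ω) (Γ : Set (EuclideanSpace ℝ (Fin n))) (hΓ : Γ ⊆ frontier Ω)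
    (A : H1 Ω →ₗ.[ℝ] H1 Ω) (Φ : C0Semigroup (H1 Ω)) (hA : IsGenerator A Φ)
    (B : EuclideanSpace ℝ (Fin p) →L[ℝ] H1 Ω) (z₀ : H1 Ω)
    (α : ℝ) (hα : α ∈ Set.Ioc (0 : ℝ) 1) (b : ℝ) (hb : 0 < b)
    (hH : ∀ u : Controls p b,
      MeasureTheory.IntegrableOn (controlIntegrand Φ α B u b) (Set.Ioo 0 b)) :
    IsControlOperator Φ α B b (H Φ α B b) ∧
    List.TFAE [
      IsExactlyRegionallyBoundaryControllable Γ Φ α B z₀ b,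
      LinearMap.range (pΓ Ω Γ ∘L γ Ω ∘L H Φ α B b).toLinearMap = ⊤,
      LinearMap.ker (pΓ Ω Γ).toLinearMap ⊔ LinearMap.range (γ Ω ∘L H Φ α B b).toLinearMap = ⊤,
      ∃ c : ℝ, 0 < c ∧ ∀ z : Hhalf Ω Γ,
        ‖z‖ ≤ c * ‖ContinuousLinearMap.adjoint (H Φ α B b)
          (ContinuousLinearMap.adjoint (γ Ω) (ContinuousLinearMap.adjoint (pΓ Ω Γ) z))‖] := by
  have hop := isControlOperator_H Φ hα.1 hα.2 B b hH
  refine ⟨hop, ?_⟩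
  have hp : Function.Surjective (pΓ Ω Γ) := fun z => by
    obtain ⟨v, rfl⟩ := (traceKer Ω Γ).mkQ_surjective z
    exact ⟨γ Ω v, rfl⟩
  tfae_have 1 ↔ 2 := by
    have hmild : ∀ u : Controls p b, mildSolution Φ α B z₀ u b = K Φ α b z₀ + H Φ α B b u :=
      fun u => by rw [hop u]; rfl
    rw [LinearMap.range_eq_top]
    constructor
    · intro h z
      -- The target is shifted by the contribution of the uncontrolled motion.
      obtain ⟨u, hu⟩ := h (pΓ Ω Γ (γ Ω (K Φ α b z₀)) + z)
      refine ⟨u, ?_⟩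
      rw [hmild, map_add, map_add] at hu
      exact add_left_cancel hu
    · intro h z
      obtain ⟨u, hu⟩ := h (z - pΓ Ω Γ (γ Ω (K Φ α b z₀)))
      refine ⟨u, ?_⟩
      have hu' : pΓ Ω Γ (γ Ω (H Φ α B b u)) = z - pΓ Ω Γ (γ Ω (K Φ α b z₀)) := hu
      rw [hmild, map_add, map_add, hu', add_sub_cancel]
  tfae_have 2 ↔ 3 := by
    have hrange : LinearMap.range (pΓ Ω Γ ∘L γ Ω ∘L H Φ α B b).toLinearMap =
        (LinearMap.range (γ Ω ∘L H Φ α B b).toLinearMap).map (pΓ Ω Γ).toLinearMap :=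
      LinearMap.range_comp _ _
    have hptop : LinearMap.range (pΓ Ω Γ).toLinearMap = ⊤ := LinearMap.range_eq_top.2 hp
    -- Ker p + S is the preimage of p(S); as p is onto, it is everything exactly when p(S) is.
    rw [hrange, sup_comm, ← Submodule.comap_map_eq]
    constructor
    · intro h; rw [h, Submodule.comap_top]
    · intro h
      have := congrArg (Submodule.map (pΓ Ω Γ).toLinearMap) h
      rwa [Submodule.map_comap_eq, hptop, top_inf_eq, Submodule.map_top, hptop] at this
  tfae_have 2 ↔ 4 := by
    rw [LinearMap.range_eq_top]
    refine (ContinuousLinearMap.surjective_iff_exists_norm_le_adjoint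
      (pΓ Ω Γ ∘L γ Ω ∘L H Φ α B b)).trans ?_
    rw [ContinuousLinearMap.adjoint_comp, ContinuousLinearMap.adjoint_comp]
    rfl
  tfae_finish
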